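/- Let $G=(V,E)$ be a strongly connected finite simple directed graph (no loops, no multiple edges); write $s(e),t(e)$ for the source and target of an edge $e$. Let $x_e$ ($e\in E$) and $y_v$ ($v\in V$) be independent indeterminates over $\mathbb C$. The *Schrödinger operator* of $G$ is the $V\times V$ matrix $L=Q+Y$, where for $v\neq w$ one has $Q_{vw}=x_e$ if there is an edge $e$ from $v$ to $w$ and $Q_{vw}=0$ otherwise, $Q_{vv}=-\sum_{e:\,s(e)=v}x_e$, and $Y$ is the diagonal matrix with $Y_{vv}=y_v$. For $W\subseteq V$ let $L_W$ be the principal submatrix of $L$ with rows and columns indexed by $W$. The set $W$ is *strongly connected* if any two vertices of $W$ are joined, in both directions, by directed paths of $G$ staying in $W$. A *spanning tree* $\mathbf a$ of $G$ is a subgraph containing all vertices, without cycles, in which one vertex (the *root*) has outdegree $0$ and all other vertices have outdegree $1$. The *tree graph* $\mathcal TG$ has the spanning trees of $G$ as its vertices; for each spanning tree $\mathbf a$ and each edge $e$ of $G$ whose source is the root of $\mathbf a$, it has an edge, of weight $x_e$, from $\mathbf a$ to the spanning tree $\mathbf b$ with root $t(e)$ obtained from $\mathbf a$ by adding $e$ and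 deleting the edge of $\mathbf a$ going out of $t(e)$. The *lifted Schrödinger operator* is $\mathcal L=\mathcal Q+\mathcal Y$, indexed by the spanning trees of $G$, where for $\mathbf a\ne\mathbf b$ the entry $\mathcal Q_{\mathbf a\mathbf b}$ is the weight of the edge of $\mathcal TG$ from $\mathbf a$ to $\mathbf b$ ($0$ if there is none), $\mathcal Q_{\mathbf a\mathbf a}=-\sum_{\mathbf b\neq\mathbf a}\mathcal Q_{\mathbf a\mathbf b}$, and $\mathcal Y$ is diagonal with $\mathcal Y_{\mathbf a\mathbf a}=y_v$ for $v$ the root of $\mathbf a$. Fix a total order on $V$. The *exploration algorithm* takes a spanning tree $\mathbf a$ with root $v$ and maintains a set $A\subseteq V$, an ordered list $\mathbf L$ of edges and a set $F\subseteq E$. Initially $A=\{v\}$, $F=\{e\in E: s(e)\ne v\}$, and $\mathbf L$ is the list of the edges with target $v$, by increasing source. While $\mathbf L$ is not empty, take its first edge $e$ and let $w=s(e)$. If $e$ is an edge of $\mathbf a$: add $w$ to $A$, delete all edges with source $w$ from $\mathbf L$, and then append at the end of $\mathbf L$ all the edges of $F$ with target $w$, by increasing source. Otherwise: delete from $\mathbf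 L$ and from $F$ all edges with source or target $w$. Let $\phi(\mathbf a)$ be the final value of $A$, and let $\psi(\mathbf a)$ be the strongly connected component of $v$ in the directed graph induced by $G$ on $\phi(\mathbf a)$. For a strongly connected $W\subseteq V$ and $w\in W$, let $m(W,w)$ be the number of spanning trees $\mathbf a$ rooted at $w$ with $\psi(\mathbf a)=W$. **Theorem 3.3.** For every nonempty strongly connected $W\subseteq V$ the number $m(W,w)$ depends neither on $w\in W$ nor on the total order on $V$; writing $m(W)$ for it, $$\det(\mathcal L)=\prod_{\substack{\emptyset\ne W\subseteq V\\ W\text{ strongly connected}}}\det(L_W)^{m(W)}.$$ -/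

import Mathlib

noncomputable section

namespace Digraph

/-- There is a directed path (possibly of length `0`) from `u` to `v` in the digraph induced by `G`
on `W`. -/
def Reaches {V : Type*} (G : Digraph V) (W : Finset V) (u v : V) : Prop :=
  Relation.ReflTransGen (fun a b => a ∈ W ∧ b ∈ W ∧ G.Adj a b) u v

/-- The subset `W` is strongly connected: the digraph induced on `W` is strongly connected. -/
def StronglyConnectedOn {V : Type*} (G : Digraph V) (W : Finset V) : Prop :=
  ∀ u ∈ W, ∀ v ∈ W, G.Reaches W u v

/-- The digraph is strongly connected. -/
def StronglyConnected {V : Type*} (G : Digraph V) : Prop :=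
  ∀ u v : V, Relation.ReflTransGen G.Adj u v

/-- The edges of `G`; `e.1.1` is the source and `e.1.2` the target. -/
abbrev Edge {V : Type*} (G : Digraph V) : Type _ := {e : V × V // G.Adj e.1 e.2}

/-- An oriented spanning tree of `G`, given by its root and its set of edges `(source, target)`:
the root has outdegree `0`, all other vertices have outdegree `1`, and there is no cycle. -/
@[ext]
structure SpanningTree {V : Type*} (G : Digraph V) where
  edges : Finset (V × V)
  root : V
  adj_of_mem : ∀ e ∈ edges, G.Adj e.1 e.2
  root_out : ∀ w, (root, w) ∉ edges
  existsUnique_out : ∀ v, v ≠ root → ∃! w, (v, w) ∈ edges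
  acyclic : ∀ v, ¬ Relation.TransGen (fun a b => (a, b) ∈ edges) v v

instance {V : Type*} (G : Digraph V) : DecidableEq G.SpanningTree := Classical.decEq _

instance {V : Type*} [Fintype V] (G : Digraph V) : Fintype G.SpanningTree :=
  @Fintype.ofFinite _ <| Finite.of_injective
    (fun a : G.SpanningTree => (a.edges, a.root)) (by
      intro a b h
      simp only [Prod.mk.injEq] at h
      exact SpanningTree.ext h.1 h.2)

/-! ### Schrödinger operators -/

/-- The Schrödinger operator `Q + Y` of a finite loopless weighted digraph with vertex set `α`,
where `x a b` is the weight of the edge from `a` to `b` (zero if there is no such edge), and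
`y a` is the weight of the vertex `a`. -/
def weightedSchrodinger {α R : Type*} [Fintype α] [DecidableEq α] [CommRing R]
    (x : α → α → R) (y : α → R) : Matrix α α R :=
  Matrix.of (fun a b => if a = b then - ∑ c ∈ Finset.univ.erase a, x a c else x a b)
    + Matrix.diagonal y

/-- The ring `ℂ[x_e, y_v]` of polynomials in indeterminates `x_e` (`e` an edge) and
`y_v` (`v` a vertex). -/
abbrev WeightRing {V : Type*} (G : Digraph V) : Type _ := MvPolynomial (G.Edge ⊕ V) ℂ

open Classical in
/-- The indeterminate `x_e` if `e = (v, w)` is an edge, and `0` otherwise. -/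
def edgeWeight {V : Type*} (G : Digraph V) (v w : V) : G.WeightRing :=
  if h : G.Adj v w then MvPolynomial.X (Sum.inl ⟨(v, w), h⟩) else 0

/-- The indeterminate `y_v`. -/
def vertexWeight {V : Type*} (G : Digraph V) (v : V) : G.WeightRing :=
  MvPolynomial.X (Sum.inr v)

/-- The Schrödinger operator `L = Q + Y` of `G`. -/
def schrodinger {V : Type*} [Fintype V] [DecidableEq V] (G : Digraph V) :
    Matrix V V G.WeightRing :=
  weightedSchrodinger G.edgeWeight G.vertexWeight

/-- The principal submatrix `L_W`, with rows and columns indexed by `W`. -/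
def schrodingerOn {V : Type*} [Fintype V] [DecidableEq V] (G : Digraph V) (W : Finset V) :
    Matrix W W G.WeightRing :=
  G.schrodinger.submatrix Subtype.val Subtype.val

/-! ### The tree graph -/

/-- The edges of the tree graph: for an edge `e` of `G` whose source is the root of `a`, there is
an edge from `a` to the tree `b`, rooted at the target of `e`, that is obtained by adding `e` to
`a` and deleting the edge of `a` going out of the target of `e`. -/
def treeGraph {V : Type*} [DecidableEq V] (G : Digraph V) : Digraph G.SpanningTree where
  Adj a b := G.Adj a.root b.root ∧
    b.edges = (insert (a.root, b.root) a.edges).filter (fun f => f.1 ≠ b.root)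

open Classical in
/-- The weight of an edge of the tree graph is the weight `x_e` of the edge of `G` from the root of
its source to the root of its target. -/
def treeEdgeWeight {V : Type*} [DecidableEq V] (G : Digraph V) (a b : G.SpanningTree) :
    G.WeightRing :=
  if G.treeGraph.Adj a b then G.edgeWeight a.root b.root else 0

/-- The Schrödinger operator lifted to the tree graph. -/
def liftedSchrodinger {V : Type*} [Fintype V] [DecidableEq V] (G : Digraph V) :
    Matrix G.SpanningTree G.SpanningTree G.WeightRing :=
  weightedSchrodinger G.treeEdgeWeight (fun a => G.vertexWeight a.root)

/-! ### The exploration algorithm -/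

/-- The running variables of the exploration algorithm: a set `A` of vertices, an ordered list `L`
of edges, and a set `F` of edges. Edges are pairs `(source, target)`. -/
structure ExploreState (V : Type*) where
  A : Finset V
  L : List (V × V)
  F : Finset (V × V)

open Classical in
/-- The finite set of all edges of `G`. -/
def edgeSet {V : Type*} [Fintype V] (G : Digraph V) : Finset (V × V) :=
  Finset.univ.filter (fun e => G.Adj e.1 e.2)

/-- The list of the elements of a finite set in increasing order, for the total order `o`. -/
def increasing {V : Type*} (o : LinearOrder V) (S : Finset V) : List V :=
  letI := o
  S.sort (fun a b => a ≤ b)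

/-- The list of the edges in `F` with target `w`, by increasing source. -/
def edgesInto {V : Type*} [Fintype V] [DecidableEq V] (o : LinearOrder V)
    (F : Finset (V × V)) (w : V) : List (V × V) :=
  (increasing o (Finset.univ.filter (fun u => (u, w) ∈ F))).map (fun u => (u, w))

/-- Initialization of the algorithm. -/
def exploreInit {V : Type*} [Fintype V] [DecidableEq V] (G : Digraph V) (o : LinearOrder V)
    (a : G.SpanningTree) : ExploreState V where
  A := {a.root}
  L := edgesInto o G.edgeSet a.root
  F := G.edgeSet.filter (fun e => e.1 ≠ a.root)

/-- One iteration of the algorithm (nothing happens once the list is empty). The first edge `e` of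
the list is examined; let `w` be its source. If `e` is in the tree, then `w` is explored; otherwise
`w` is erased. -/
def exploreStep {V : Type*} [Fintype V] [DecidableEq V] (G : Digraph V) (o : LinearOrder V)
    (a : G.SpanningTree) (s : ExploreState V) : ExploreState V :=
  match s.L with
  | [] => s
  | e :: _ =>
    if e ∈ a.edges then
      { A := insert e.1 s.A
        L := s.L.filter (fun f => f.1 ≠ e.1) ++ edgesInto o s.F e.1
        F := s.F }
    else
      { A := s.A
        L := s.L.filter (fun f => f.1 ≠ e.1 ∧ f.2 ≠ e.1)
        F := s.F.filter (fun f => f.1 ≠ e.1 ∧ f.2 ≠ e.1) }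

/-- The final state. The loop runs until the list is empty, which takes at most as many iterations
as there are edges (see `exploreFinal_L`). -/
def exploreFinal {V : Type*} [Fintype V] [DecidableEq V] (G : Digraph V) (o : LinearOrder V)
    (a : G.SpanningTree) : ExploreState V :=
  (G.exploreStep o a)^[G.edgeSet.card] (G.exploreInit o a)

/-- The set `φ(a)` of explored vertices. -/
def explored {V : Type*} [Fintype V] [DecidableEq V] (G : Digraph V) (o : LinearOrder V)
    (a : G.SpanningTree) : Finset V :=
  (G.exploreFinal o a).A

open Classical in
/-- The set `ψ(a)`: the strongly connected component of the root of `a` in the digraph induced by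
`G` on `φ(a)`. -/
def psi {V : Type*} [Fintype V] [DecidableEq V] (G : Digraph V) (o : LinearOrder V)
    (a : G.SpanningTree) : Finset V :=
  (G.explored o a).filter (fun u =>
    G.Reaches (G.explored o a) a.root u ∧ G.Reaches (G.explored o a) u a.root)

/-- The multiplicity `m(W, w)` of `W` at `w`, for the total order `o` on the vertices: the number of
oriented spanning trees `a` rooted at `w` with `ψ(a) = W`. -/
def multiplicity {V : Type*} [Fintype V] [DecidableEq V] (G : Digraph V) (o : LinearOrder V)
    (W : Finset V) (w : V) : ℕ :=
  (Finset.univ.filter (fun a : G.SpanningTree => a.root = w ∧ G.psi o a = W)).card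

open Classical in
/-- The strongly connected subsets of the vertex set. (The empty set is included by convention; the
principal submatrix on it has determinant `1`.) -/
def stronglyConnectedSubsets {V : Type*} [Fintype V] (G : Digraph V) : Finset (Finset V) :=
  Finset.univ.filter (fun W => G.StronglyConnectedOn W)

/-! ### Termination of the algorithm -/

theorem mem_edgesInto {V : Type*} [Fintype V] [DecidableEq V] (o : LinearOrder V)
    (F : Finset (V × V)) (w : V) (e : V × V) : e ∈ edgesInto o F w ↔ e ∈ F ∧ e.2 = w := by
  obtain ⟨u, v⟩ := e
  simp only [edgesInto, increasing, List.mem_map, Finset.mem_sort, Finset.mem_filter,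
    Finset.mem_univ, true_and, Prod.mk.injEq]
  constructor
  · rintro ⟨x, hx, rfl, rfl⟩
    exact ⟨hx, rfl⟩
  · rintro ⟨h, rfl⟩
    exact ⟨u, h, rfl, rfl⟩

theorem length_edgesInto {V : Type*} [Fintype V] [DecidableEq V] (o : LinearOrder V)
    (F : Finset (V × V)) (w : V) :
    (edgesInto o F w).length = (F.filter (fun e => e.2 = w)).card := by
  simp only [edgesInto, increasing, List.length_map, Finset.length_sort]
  refine Finset.card_bij (fun u _ => (u, w)) ?_ ?_ ?_
  · intro u hu
    simpa using hu
  · intro u _ v _ h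
    exact (Prod.mk.inj h).1
  · rintro ⟨u, v⟩ h
    rw [Finset.mem_filter] at h
    obtain ⟨h1, h2⟩ := h
    simp only at h2
    subst h2
    exact ⟨u, by simpa using h1, rfl⟩

/-- An invariant of the loop: a tree edge whose source is explored has an explored target, and is no
longer in the list; the set `F` consists of edges of `G`. -/
def ExploreInv {V : Type*} [Fintype V] (G : Digraph V)
    (a : G.SpanningTree) (s : ExploreState V) : Prop :=
  (∀ e ∈ a.edges, e.1 ∈ s.A → e.2 ∈ s.A ∧ e ∉ s.L) ∧ (∀ e ∈ s.L, e.2 ∈ s.A) ∧ s.F ⊆ G.edgeSet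

/-- The length of the list plus the number of edges with unexplored target. -/
def exploreFuel {V : Type*} [Fintype V] [DecidableEq V] (G : Digraph V)
    (s : ExploreState V) : ℕ :=
  s.L.length + (G.edgeSet.filter (fun e => e.2 ∉ s.A)).card

theorem exploreStep_spec {V : Type*} [Fintype V] [DecidableEq V] (G : Digraph V)
    (o : LinearOrder V) (a : G.SpanningTree) (s : ExploreState V) (hs : ExploreInv G a s) :
    ExploreInv G a (G.exploreStep o a s) ∧
      (G.exploreFuel (G.exploreStep o a s) < G.exploreFuel s ∨ (G.exploreStep o a s).L = []) := by
  obtain ⟨h1, h2, h3⟩ := hs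
  obtain ⟨A, L, F⟩ := s
  simp only at h1 h2 h3
  cases L with
  | nil => exact ⟨⟨h1, h2, h3⟩, Or.inr rfl⟩
  | cons e l =>
    by_cases he : e ∈ a.edges
    · have hwA : e.1 ∉ A := fun h => (h1 e he h).2 List.mem_cons_self
      have huA : e.2 ∈ A := h2 e List.mem_cons_self
      simp only [exploreStep, he, if_true]
      refine ⟨⟨?_, ?_, h3⟩, Or.inl ?_⟩
      · intro f hf hfA
        simp only [Finset.mem_insert] at hfA ⊢
        rcases hfA with hfA | hfA
        · have hfe : f = e := by
            have hr : e.1 ≠ a.root := by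
              intro h
              apply a.root_out e.2
              rw [← h]
              exact he
            have := (a.existsUnique_out e.1 hr).unique (y₁ := f.2) (y₂ := e.2)
              (by rw [← hfA]; exact hf) he
            exact Prod.ext hfA this
          subst hfe
          refine ⟨Or.inr huA, ?_⟩
          rw [List.mem_append, mem_edgesInto]
          rintro (h | h)
          · simp at h
          · exact hwA (h.2 ▸ huA)
        · obtain ⟨h4, h5⟩ := h1 f hf hfA
          refine ⟨Or.inr h4, ?_⟩
          rw [List.mem_append, mem_edgesInto]
          rintro (h | h)
          · exact h5 (List.mem_of_mem_filter h)
          · exact hwA (h.2 ▸ h4)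
      · intro f hf
        simp only [Finset.mem_insert]
        rw [List.mem_append, mem_edgesInto] at hf
        rcases hf with h | h
        · exact Or.inr (h2 f (List.mem_of_mem_filter h))
        · exact Or.inl h.2
      · simp only [exploreFuel, List.length_append, length_edgesInto]
        have c1 : ((e :: l).filter (fun f => decide (f.1 ≠ e.1))).length < (e :: l).length := by
          rw [List.filter_cons_of_neg (by simp)]
          exact Nat.lt_succ_of_le (List.length_filter_le _ _)
        have c2 : (F.filter (fun f => f.2 = e.1)).card
            + (G.edgeSet.filter (fun f => f.2 ∉ insert e.1 A)).card
            ≤ (G.edgeSet.filter (fun f => f.2 ∉ A)).card := by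
          rw [← Finset.card_union_of_disjoint]
          · apply Finset.card_le_card
            intro f hf
            simp only [Finset.mem_union, Finset.mem_filter, Finset.mem_insert, not_or] at hf ⊢
            rcases hf with hf | hf
            · exact ⟨h3 hf.1, hf.2 ▸ hwA⟩
            · exact ⟨hf.1, hf.2.2⟩
          · rw [Finset.disjoint_left]
            intro f hf hf'
            simp only [Finset.mem_filter, Finset.mem_insert, not_or] at hf hf'
            exact hf'.2.1 hf.2
        omega
    · simp only [exploreStep, he, if_false]
      refine ⟨⟨?_, ?_, ?_⟩, Or.inl ?_⟩
      · intro f hf hfA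
        refine ⟨(h1 f hf hfA).1, fun h => (h1 f hf hfA).2 ?_⟩
        exact (List.mem_filter.mp h).1
      · intro f hf
        exact h2 f (List.mem_filter.mp hf).1
      · exact (Finset.filter_subset _ _).trans h3
      · simp only [exploreFuel]
        rw [List.filter_cons_of_neg (by simp)]
        have := List.length_filter_le (fun f => decide (f.1 ≠ e.1 ∧ f.2 ≠ e.1)) l
        simp only [List.length_cons]
        omega

/-- The algorithm has terminated: the list is empty in the final state. -/
theorem exploreFinal_L {V : Type*} [Fintype V] [DecidableEq V] (G : Digraph V)
    (o : LinearOrder V) (a : G.SpanningTree) :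
    (G.exploreFinal o a).L = [] := by
  have key : ∀ n (s : ExploreState V), ExploreInv G a s → G.exploreFuel s ≤ n →
      ((G.exploreStep o a)^[n] s).L = [] := by
    intro n
    induction n with
    | zero =>
      intro s _ hn
      simp only [exploreFuel] at hn
      exact List.length_eq_zero_iff.mp (by simpa using (by omega : s.L.length = 0))
    | succ n ih =>
      intro s hs hn
      rw [Function.iterate_succ_apply]
      obtain ⟨h1, h2⟩ := G.exploreStep_spec o a s hs
      rcases h2 with h2 | h2
      · exact ih _ h1 (by omega)
      · have hfix : G.exploreStep o a (G.exploreStep o a s) = G.exploreStep o a s := by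
          conv_lhs => rw [exploreStep]
          rw [h2]
        rw [Function.iterate_fixed hfix, h2]
  refine key _ _ ⟨?_, ?_, Finset.filter_subset _ _⟩ ?_
  · intro e he h
    simp only [exploreInit, Finset.mem_singleton] at h
    exact absurd (h ▸ he : (a.root, e.2) ∈ a.edges) (a.root_out _)
  · intro e he
    simp only [exploreInit, mem_edgesInto] at he ⊢
    simp [he.2]
  · simp only [exploreInit, exploreFuel, length_edgesInto, Finset.mem_singleton]
    exact (Finset.card_filter_add_card_filter_not _).le

end Digraph

end

/-!
The proof compares traces of powers. In characteristic zero a finite multiset of elements of a field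
is determined by its power sums, so the determinant of the lifted operator is the product of the
`(det L_W) ^ m W` as soon as, for every `k`, the trace of its `k`-th power is the sum of the
`m W * tr (L_W ^ k)` (`Matrix.det_eq_prod_det_pow_of_trace_pow`).

Both sides count closed walks of `G`, where the diagonal entries of `L` are weights of loops. The
trace of `L_W ^ k` is the sum of the weights of the closed walks of length `k` inside `W`. A walk of
`G` lifts uniquely to the tree graph once the initial tree is chosen, with the right root. At the
end of the lift the edge leaving a visited vertex is the last one that the walk took from there, and
the edges leaving the other vertices have not changed. Hence the closed lifts of a closed walk with
set of visited vertices `S` correspond to the edges that can be put outside `S`, that is, to the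
spanning forests with set of roots `S` (`card_moves_eq_self`). Since `S` is strongly connected, it
suffices that, for every strongly connected `S`, the sum of the `m W` over the strongly connected
`W ⊇ S` is the number of spanning forests with set of roots `S`.

For `w ∈ S` this sum counts the trees with root `w` for which the exploration algorithm explores all
of `S`, because `S ⊆ ψ(a)` if and only if `S ⊆ φ(a)`. Such a tree contains, for each vertex of
`S` other than `w`, the first edge out of it that the algorithm examines, since a rejected edge
erases its source for ever. So the tree is determined by its edges outside `S`, which form a forest
(`eq_of_outside_eq_of_subset_explored`). Conversely, given a forest, the algorithm can be run with
this forced choice at the vertices of `S`. It reaches all of `S` by strong connectivity, and its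
accepted edges complete the forest to a tree (`exists_outside_eq`). The resulting equations
(`sum_multiplicity`) are triangular with respect to inclusion and involve neither `w` nor the order,
so that they also give the independence of the multiplicities from both (`multiplicity_eq`).
-/

/-! ### Determinants and traces of powers -/

open Polynomial in
/-- Spectral mapping for determinants: `det p(M)` is the product of the values of `p` at the
eigenvalues of `M`, with multiplicity. -/
theorem Matrix.det_aeval_eq_prod_roots {n K : Type*} [Fintype n] [DecidableEq n] [Field K]
    [IsAlgClosed K] (M : Matrix n n K) (p : K[X]) :
    (aeval M p).det = (M.charpoly.roots.map (fun r => p.eval r)).prod := by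
  have hM : M.charpoly = (M.charpoly.roots.map (fun r => X - C r)).prod :=
    ((IsAlgClosed.splits M.charpoly).eq_prod_roots_of_monic M.charpoly_monic)
  have hcard : M.charpoly.roots.card = Fintype.card n := by
    rw [← M.charpoly_natDegree_eq_dim, ← (IsAlgClosed.splits M.charpoly).natDegree_eq_card_roots]
  have hlin : ∀ t : K, (aeval M (X - C t)).det
      = (M.charpoly.roots.map (fun r => (X - C t).eval r)).prod := by
    intro t
    have h1 : aeval M (X - C t) = - (Matrix.scalar n t - M) := by
      simp [Matrix.algebraMap_eq_diagonal, Matrix.scalar_apply, Pi.algebraMap_def]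
    have h2 : eval t M.charpoly = (M.charpoly.roots.map (fun r => t - r)).prod := by
      conv_lhs => rw [hM]
      rw [Polynomial.eval_multiset_prod, Multiset.map_map]
      simp
    rw [h1, Matrix.det_neg, ← Matrix.eval_charpoly, ← hcard, h2,
      ← Multiset.card_map (fun r => t - r), ← Multiset.prod_map_neg, Multiset.map_map]
    simp
  have hprod : ∀ s : Multiset K, (aeval M (s.map (fun t => X - C t)).prod).det
      = (M.charpoly.roots.map (fun r => (s.map (fun t => X - C t)).prod.eval r)).prod := by
    intro s
    induction s using Multiset.induction_on with
    | empty => simp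
    | cons t s ih =>
      simp only [Multiset.map_cons, Multiset.prod_cons, map_mul, Matrix.det_mul, hlin, ih,
        eval_mul, Multiset.prod_map_mul]
  rw [(IsAlgClosed.splits p).eq_prod_roots]
  simp only [map_mul, aeval_C, Matrix.det_mul, hprod, eval_mul, eval_C, Multiset.prod_map_mul,
    Multiset.map_const', Multiset.prod_replicate, hcard]
  congr 1
  simp [Matrix.algebraMap_eq_diagonal, Pi.algebraMap_def]

open Polynomial in
theorem Matrix.roots_charpoly_pow {n K : Type*} [Fintype n] [DecidableEq n] [Field K]
    [IsAlgClosed K] (M : Matrix n n K) (k : ℕ) :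
    (M ^ k).charpoly.roots = M.charpoly.roots.map (· ^ k) := by
  have hcard : M.charpoly.roots.card = Fintype.card n := by
    rw [← M.charpoly_natDegree_eq_dim, ← (IsAlgClosed.splits M.charpoly).natDegree_eq_card_roots]
  have : (M ^ k).charpoly = ((M.charpoly.roots.map (· ^ k)).map (fun r => X - C r)).prod := by
    refine Polynomial.funext fun t => ?_
    have h := M.det_aeval_eq_prod_roots (C t - X ^ k)
    rw [Matrix.eval_charpoly]
    convert h using 1
    · congr 1
      simp [Matrix.algebraMap_eq_diagonal, Matrix.scalar_apply, Pi.algebraMap_def]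
    · rw [Polynomial.eval_multiset_prod, Multiset.map_map, Multiset.map_map]
      simp
  rw [this, Polynomial.roots_multiset_prod_X_sub_C]

theorem Matrix.trace_pow_eq_sum_roots {n K : Type*} [Fintype n] [DecidableEq n] [Field K]
    [IsAlgClosed K] (M : Matrix n n K) (k : ℕ) :
    (M ^ k).trace = (M.charpoly.roots.map (· ^ k)).sum := by
  rw [Matrix.trace_eq_sum_roots_charpoly, M.roots_charpoly_pow]

theorem Matrix.map_trace_pow_eq_sum_roots {n R K : Type*} [Fintype n] [DecidableEq n]
    [CommRing R] [Field K] [IsAlgClosed K] (f : R →+* K) (A : Matrix n n R) (k : ℕ) :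
    f (A ^ k).trace = ((A.map f).charpoly.roots.map (· ^ k)).sum := by
  rw [← Matrix.trace_pow_eq_sum_roots, ← RingHom.mapMatrix_apply, ← map_pow]
  simp [Matrix.trace]

/-- In characteristic zero a finite multiset is determined by its power sums, including the
zeroth one. This is Dedekind's independence of the characters `k ↦ r ^ k` of `ℕ`. -/
theorem Multiset.eq_of_sum_map_pow_eq {K : Type*} [Field K] [CharZero K] (s t : Multiset K)
    (h : ∀ k : ℕ, (s.map (· ^ k)).sum = (t.map (· ^ k)).sum) : s = t := by
  classical
  have hinj : Function.Injective (fun r : K => powersHom K r) := (powersHom K).injective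
  have hli := (linearIndependent_monoidHom (Multiplicative ℕ) K).comp _ hinj
  rw [linearIndependent_iff'] at hli
  have hsum : ∀ (u : Multiset K) (k : ℕ), u ⊆ s + t →
      (u.map (· ^ k)).sum = ∑ r ∈ (s + t).toFinset, (u.count r : K) * r ^ k := by
    intro u k hu
    rw [Finset.sum_multiset_map_count]
    simp only [nsmul_eq_mul]
    refine Finset.sum_subset (Multiset.toFinset_subset.mpr hu) fun r _ hr => ?_
    rw [Multiset.mem_toFinset] at hr
    simp [Multiset.count_eq_zero_of_notMem hr]
  have h0 := hli (s + t).toFinset (fun r => (s.count r : K) - t.count r) (by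
    funext k
    have hk := h (Multiplicative.toAdd k)
    rw [hsum s _ (Multiset.subset_of_le (Multiset.le_add_right _ _)),
      hsum t _ (Multiset.subset_of_le (Multiset.le_add_left _ _)), ← sub_eq_zero,
      ← Finset.sum_sub_distrib] at hk
    simpa [Finset.sum_apply, sub_mul] using hk)
  ext r
  by_cases hr : r ∈ (s + t).toFinset
  · have := h0 r hr
    exact_mod_cast sub_eq_zero.mp this
  · simp only [Multiset.mem_toFinset, Multiset.mem_add, not_or] at hr
    rw [Multiset.count_eq_zero_of_notMem hr.1, Multiset.count_eq_zero_of_notMem hr.2]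

/-- If the traces of all powers of `N` are those of the block sum of `m i` copies of each `M i`,
then so is its determinant. -/
theorem Matrix.det_eq_prod_det_pow_of_trace_pow {R ι n : Type*} [CommRing R] [IsDomain R]
    [CharZero R] [Fintype n] [DecidableEq n] (s : Finset ι) (κ : ι → Type*)
    [∀ i, Fintype (κ i)] [∀ i, DecidableEq (κ i)] (N : Matrix n n R)
    (M : ∀ i, Matrix (κ i) (κ i) R) (m : ι → ℕ)
    (h : ∀ k : ℕ, (N ^ k).trace = ∑ i ∈ s, m i * (M i ^ k).trace) :
    N.det = ∏ i ∈ s, (M i).det ^ m i := by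
  let K := AlgebraicClosure (FractionRing R)
  let f : R →+* K := (algebraMap (FractionRing R) K).comp (algebraMap R (FractionRing R))
  have hf : Function.Injective f :=
    (algebraMap (FractionRing R) K).injective.comp (IsFractionRing.injective R _)
  have : CharZero K := charZero_of_injective_ringHom hf
  have hroots : (N.map f).charpoly.roots = ∑ i ∈ s, m i • ((M i).map f).charpoly.roots := by
    refine Multiset.eq_of_sum_map_pow_eq _ _ fun k => ?_
    have hk := congrArg f (h k)
    simp only [map_sum, map_mul, map_natCast] at hk
    rw [← Multiset.coe_mapAddMonoidHom, ← Multiset.coe_sumAddMonoidHom, map_sum, map_sum,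
      Multiset.coe_mapAddMonoidHom, Multiset.coe_sumAddMonoidHom,
      ← Matrix.map_trace_pow_eq_sum_roots, hk]
    refine Finset.sum_congr rfl fun i _ => ?_
    rw [Matrix.map_trace_pow_eq_sum_roots, Multiset.map_nsmul, Multiset.sum_nsmul, nsmul_eq_mul]
  apply hf
  rw [map_prod, RingHom.map_det, RingHom.mapMatrix_apply, Matrix.det_eq_prod_roots_charpoly,
    hroots, Multiset.prod_sum]
  refine Finset.prod_congr rfl fun i _ => ?_
  rw [Multiset.prod_nsmul, map_pow, RingHom.map_det, RingHom.mapMatrix_apply,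
    Matrix.det_eq_prod_roots_charpoly]

noncomputable section

namespace Digraph

/-! ### Spanning trees and spanning forests -/

theorem SpanningTree.reflTransGen_root {V : Type*} [Finite V] {G : Digraph V}
    (a : G.SpanningTree) (v : V) :
    Relation.ReflTransGen (fun u w => (u, w) ∈ a.edges) v a.root := by
  let r : V → V → Prop := fun x y => Relation.TransGen (fun u w => (u, w) ∈ a.edges) y x
  have : IsTrans V r := ⟨fun x y z hxy hyz => hyz.trans hxy⟩
  have : Std.Irrefl r := ⟨fun x hx => a.acyclic x hx⟩
  induction v using (Finite.wellFounded_of_trans_of_irrefl r).induction with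
  | _ v ih =>
    by_cases hv : v = a.root
    · rw [hv]
    · obtain ⟨w, hw, -⟩ := a.existsUnique_out v hv
      exact Relation.ReflTransGen.head hw (ih w (Relation.TransGen.single hw))

/-- The spanning tree with given edges, when acyclicity is replaced by the condition that every
vertex has a path to the root. -/
def SpanningTree.ofReflTransGen {V : Type*} {G : Digraph V} (E : Finset (V × V)) (r : V)
    (hadj : ∀ e ∈ E, G.Adj e.1 e.2) (hroot : ∀ w, (r, w) ∉ E)
    (hout : ∀ v, v ≠ r → ∃! w, (v, w) ∈ E)
    (hreach : ∀ v, Relation.ReflTransGen (fun u w => (u, w) ∈ E) v r) : G.SpanningTree where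
  edges := E
  root := r
  adj_of_mem := hadj
  root_out := hroot
  existsUnique_out := hout
  acyclic v := by
    induction hreach v using Relation.ReflTransGen.head_induction_on with
    | refl =>
      intro h
      obtain ⟨w, hw, -⟩ := Relation.TransGen.head'_iff.mp h
      exact hroot w hw
    | @head x y hxy _ ih =>
      intro h
      obtain ⟨w, hw, hwx⟩ := Relation.TransGen.head'_iff.mp h
      have hx : x ≠ r := fun h => hroot y (h ▸ hxy)
      have : w = y := (hout x hx).unique hw hxy
      exact ih (Relation.TransGen.tail' (this ▸ hwx) hxy)

/-- The set of edges `f` is a spanning forest of `G` with set of roots `S`: the vertices of `S` have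
outdegree `0`, the others have outdegree `1` and a path to `S`. -/
structure IsForest {V : Type*} (G : Digraph V) (S : Finset V) (f : Finset (V × V)) : Prop where
  adj : ∀ e ∈ f, G.Adj e.1 e.2
  source_notMem : ∀ e ∈ f, e.1 ∉ S
  existsUnique_out : ∀ v ∉ S, ∃! w, (v, w) ∈ f
  reaches : ∀ v, ∃ s ∈ S, Relation.ReflTransGen (fun u w => (u, w) ∈ f) v s

open Classical in
/-- The set of spanning forests of `G` with set of roots `S`. -/
def forests {V : Type*} [Fintype V] (G : Digraph V) (S : Finset V) : Finset (Finset (V × V)) :=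
  Finset.univ.filter (G.IsForest S)

/-- The edges of the tree `a` whose source is not in `S`. -/
def SpanningTree.outside {V : Type*} [DecidableEq V] {G : Digraph V} (a : G.SpanningTree)
    (S : Finset V) : Finset (V × V) :=
  a.edges.filter (fun e => e.1 ∉ S)

theorem SpanningTree.mem_outside {V : Type*} [DecidableEq V] {G : Digraph V}
    {a : G.SpanningTree} {S : Finset V} {e : V × V} :
    e ∈ a.outside S ↔ e ∈ a.edges ∧ e.1 ∉ S :=
  Finset.mem_filter

theorem SpanningTree.isForest_outside {V : Type*} [Finite V] [DecidableEq V] {G : Digraph V}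
    (a : G.SpanningTree) {S : Finset V} (ha : a.root ∈ S) : G.IsForest S (a.outside S) where
  adj e he := a.adj_of_mem e (mem_outside.mp he).1
  source_notMem e he := (mem_outside.mp he).2
  existsUnique_out v hv := by
    have h := a.existsUnique_out v (fun h => hv (h ▸ ha))
    simpa [mem_outside, hv] using h
  reaches v := by
    induction a.reflTransGen_root v using Relation.ReflTransGen.head_induction_on with
    | refl => exact ⟨a.root, ha, .refl⟩
    | @head x y hxy _ ih =>
      by_cases hx : x ∈ S
      · exact ⟨x, hx, .refl⟩
      · obtain ⟨s, hs, h⟩ := ih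
        exact ⟨s, hs, .head (mem_outside.mpr ⟨hxy, hx⟩) h⟩

/-- Trees with the same root are equal if they agree on the edges leaving `S` and on the edges
leaving the complement of `S`. -/
theorem SpanningTree.ext_of_outside_eq {V : Type*} [DecidableEq V] {G : Digraph V}
    {a b : G.SpanningTree} {S : Finset V} (hroot : a.root = b.root)
    (hout : a.outside S = b.outside S)
    (hin : ∀ e : V × V, e.1 ∈ S → (e ∈ a.edges ↔ e ∈ b.edges)) : a = b := by
  refine SpanningTree.ext ?_ hroot
  ext e
  by_cases he : e.1 ∈ S
  · exact hin e he
  · have := congrArg (e ∈ ·) hout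
    simpa [mem_outside, he] using this

/-! ### The exploration algorithm restricted to the trees that explore a given set -/

/-- The vertex `u` is unexplored and can no longer be explored, because none of its outgoing edges
remains available. -/
def IsErased {V : Type*} (u : V) (s : ExploreState V) : Prop :=
  u ∉ s.A ∧ (∀ e ∈ s.L, e.1 ≠ u) ∧ ∀ e ∈ s.F, e.1 ≠ u

theorem IsErased.exploreStep {V : Type*} [Fintype V] [DecidableEq V] {G : Digraph V}
    {o : LinearOrder V} {a : G.SpanningTree} {u : V} {s : ExploreState V} (hs : IsErased u s) :
    IsErased u (G.exploreStep o a s) := by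
  obtain ⟨h1, h2, h3⟩ := hs
  obtain ⟨A, L, F⟩ := s
  cases L with
  | nil => exact ⟨h1, h2, h3⟩
  | cons e l =>
    have he := h2 e List.mem_cons_self
    by_cases hea : e ∈ a.edges
    · simp only [Digraph.exploreStep, hea, if_true]
      refine ⟨?_, ?_, h3⟩
      · simpa [Finset.mem_insert, he.symm] using h1
      · intro g hg
        rw [List.mem_append, mem_edgesInto] at hg
        rcases hg with hg | hg
        · exact h2 g (List.mem_of_mem_filter hg)
        · exact h3 g hg.1
    · simp only [Digraph.exploreStep, hea, if_false]
      refine ⟨h1, fun g hg => h2 g (List.mem_filter.mp hg).1, fun g hg => ?_⟩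
      exact h3 g (Finset.mem_filter.mp hg).1

/-- If the first edge `e` of the list leaves an unexplored vertex that the algorithm eventually
explores, then `e` is an edge of the tree. -/
theorem mem_edges_of_mem_explored {V : Type*} [Fintype V] [DecidableEq V] {G : Digraph V}
    {o : LinearOrder V} {a : G.SpanningTree} {n : ℕ} (hn : n < G.edgeSet.card) {e : V × V}
    {l : List (V × V)}
    (hL : ((G.exploreStep o a)^[n] (G.exploreInit o a)).L = e :: l)
    (heA : e.1 ∉ ((G.exploreStep o a)^[n] (G.exploreInit o a)).A)
    (he : e.1 ∈ G.explored o a) : e ∈ a.edges := by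
  by_contra hea
  have h1 : IsErased e.1 ((G.exploreStep o a)^[n + 1] (G.exploreInit o a)) := by
    rw [Function.iterate_succ_apply']
    generalize (G.exploreStep o a)^[n] (G.exploreInit o a) = s at hL heA
    obtain ⟨A, L, F⟩ := s
    simp only at hL heA
    subst hL
    simp only [exploreStep, hea, if_false]
    exact ⟨heA, fun g hg => by simpa using (of_decide_eq_true (List.mem_filter.mp hg).2).1,
      fun g hg => (Finset.mem_filter.mp hg).2.1⟩
  have h2 : ∀ k, IsErased e.1 ((G.exploreStep o a)^[k + (n + 1)] (G.exploreInit o a)) := by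
    intro k
    induction k with
    | zero => simpa using h1
    | succ k ih =>
      rw [Nat.succ_add, Function.iterate_succ_apply']
      exact ih.exploreStep
  have h3 := h2 (G.edgeSet.card - (n + 1))
  rw [Nat.sub_add_cancel hn] at h3
  exact h3.1 he

/-- A tree that explores `S` is determined by its root and its edges outside `S`: at the vertices of
`S` the algorithm is forced to accept the first edge it examines. -/
theorem eq_of_outside_eq_of_subset_explored {V : Type*} [Fintype V] [DecidableEq V]
    {G : Digraph V} {o : LinearOrder V} {a b : G.SpanningTree} {S : Finset V}
    (hroot : a.root = b.root) (ha : S ⊆ G.explored o a) (hb : S ⊆ G.explored o b)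
    (hout : a.outside S = b.outside S) : a = b := by
  have key : ∀ n ≤ G.edgeSet.card,
      (G.exploreStep o a)^[n] (G.exploreInit o a) = (G.exploreStep o b)^[n] (G.exploreInit o b) ∧
      ∀ e : V × V, e.1 ∈ ((G.exploreStep o a)^[n] (G.exploreInit o a)).A →
        (e ∈ a.edges ↔ e ∈ b.edges) := by
    intro n
    induction n with
    | zero =>
      refine fun _ => ⟨by simp [exploreInit, hroot], fun e he => ?_⟩
      simp only [Function.iterate_zero, id, exploreInit, Finset.mem_singleton] at he
      have h1 := a.root_out e.2
      have h2 := b.root_out e.2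
      rw [← hroot] at h2
      rw [← he] at h1 h2
      exact iff_of_false h1 h2
    | succ n ih =>
      intro hn
      obtain ⟨h1, h2⟩ := ih (by omega)
      have hma := @mem_edges_of_mem_explored V _ _ G o a n (by omega)
      have hmb := @mem_edges_of_mem_explored V _ _ G o b n (by omega)
      simp only [Function.iterate_succ_apply']
      rw [← h1] at hmb ⊢
      generalize (G.exploreStep o a)^[n] (G.exploreInit o a) = s at *
      obtain ⟨A, L, F⟩ := s
      cases L with
      | nil => exact ⟨rfl, h2⟩
      | cons e l =>
        have hee : e ∈ a.edges ↔ e ∈ b.edges := by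
          by_cases heS : e.1 ∈ S
          · by_cases heA : e.1 ∈ A
            · exact h2 e heA
            · exact iff_of_true (hma rfl heA (ha heS)) (hmb rfl heA (hb heS))
          · have := congrArg (e ∈ ·) hout
            simpa [SpanningTree.mem_outside, heS] using this
        by_cases hea : e ∈ a.edges
        · have heb := hee.mp hea
          simp only [exploreStep, hea, heb, if_true, true_and]
          intro g hg
          rcases Finset.mem_insert.mp hg with hg | hg
          · have h3 : e.1 ≠ a.root := fun h => a.root_out e.2 (h ▸ hea)
            have h4 := a.existsUnique_out e.1 h3
            have h5 := b.existsUnique_out e.1 (hroot ▸ h3)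
            have : g = (e.1, g.2) := Prod.ext hg rfl
            rw [this]
            constructor
            · intro h
              rw [h4.unique h hea]
              exact heb
            · intro h
              rw [h5.unique h heb]
              exact hea
          · exact h2 g hg
        · have heb : e ∉ b.edges := mt hee.mpr hea
          simp only [exploreStep, hea, heb, if_false, true_and]
          exact h2
  exact SpanningTree.ext_of_outside_eq hroot hout fun e he => (key _ le_rfl).2 e (ha he)

/-! ### The forced exploration -/

/-- The exploration algorithm guided by a forest `f` with set of roots `S` instead of a tree: an
edge is accepted if it belongs to `f`, or if its source is an unexplored vertex of `S`. The second
component records the accepted edges. -/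
def forcedStep {V : Type*} [Fintype V] [DecidableEq V] (o : LinearOrder V) (S : Finset V)
    (f : Finset (V × V)) (p : ExploreState V × Finset (V × V)) :
    ExploreState V × Finset (V × V) :=
  match p.1.L with
  | [] => p
  | e :: _ =>
    if e ∈ f ∨ (e.1 ∈ S ∧ e.1 ∉ p.1.A) then
      ({ A := insert e.1 p.1.A
         L := p.1.L.filter (fun g => g.1 ≠ e.1) ++ edgesInto o p.1.F e.1
         F := p.1.F }, insert e p.2)
    else
      ({ A := p.1.A
         L := p.1.L.filter (fun g => g.1 ≠ e.1 ∧ g.2 ≠ e.1)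
         F := p.1.F.filter (fun g => g.1 ≠ e.1 ∧ g.2 ≠ e.1) }, p.2)

/-- The initial state of the forced exploration from the vertex `w`. -/
def forcedInit {V : Type*} [Fintype V] [DecidableEq V] (G : Digraph V) (o : LinearOrder V)
    (w : V) : ExploreState V × Finset (V × V) :=
  ({ A := {w}
     L := edgesInto o G.edgeSet w
     F := G.edgeSet.filter (fun e => e.1 ≠ w) }, ∅)

/-- The invariant of the forced exploration. The accepted edges form a tree on the explored
vertices, rooted at `w` and compatible with `f`. The edges between unexplored vertices of `S` and
other vertices of `S` are never discarded (`live_list`, `live_F`). The list may contain edges whose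
source `x` has already been explored; examining them erases `x`, but since the list is a queue no
edge with target `x` is left in it by then (`queue`). -/
structure ForcedInv {V : Type*} (G : Digraph V) (S : Finset V) (f : Finset (V × V)) (w : V)
    (p : ExploreState V × Finset (V × V)) : Prop where
  root_mem : w ∈ p.1.A
  adj : ∀ e ∈ p.2, G.Adj e.1 e.2
  source_mem : ∀ e ∈ p.2, e.1 ∈ p.1.A
  target_mem : ∀ e ∈ p.2, e.2 ∈ p.1.A
  source_ne : ∀ e ∈ p.2, e.1 ≠ w
  existsUnique_out : ∀ u ∈ p.1.A, u ≠ w → ∃! t, (u, t) ∈ p.2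
  reaches : ∀ u ∈ p.1.A, Relation.ReflTransGen (fun u v => (u, v) ∈ p.2) u w
  mem_forest : ∀ e ∈ p.2, e.1 ∉ S → e ∈ f
  notMem_list : ∀ e ∈ p.2, e ∉ p.1.L
  list_adj : ∀ e ∈ p.1.L, G.Adj e.1 e.2
  list_source_ne : ∀ e ∈ p.1.L, e.1 ≠ w
  list_target_mem : ∀ e ∈ p.1.L, e.2 ∈ p.1.A
  F_adj : ∀ e ∈ p.1.F, G.Adj e.1 e.2
  F_source_ne : ∀ e ∈ p.1.F, e.1 ≠ w
  live_list : ∀ u ∈ S, u ∉ p.1.A → ∀ t ∈ S, G.Adj u t → t ∈ p.1.A → (u, t) ∈ p.1.L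
  live_F : ∀ u ∈ S, u ∉ p.1.A → ∀ t ∈ S, G.Adj u t → t ∉ p.1.A → (u, t) ∈ p.1.F
  queue : p.1.L.Pairwise (fun e g => e.1 ∈ p.1.A → g.2 ≠ e.1)

theorem mem_edgeSet {V : Type*} [Fintype V] {G : Digraph V} {e : V × V} :
    e ∈ G.edgeSet ↔ G.Adj e.1 e.2 := by
  simp [edgeSet]

theorem forcedInv_forcedInit {V : Type*} [Fintype V] [DecidableEq V] {G : Digraph V}
    (hloop : ∀ v, ¬ G.Adj v v) (o : LinearOrder V) (S : Finset V) (f : Finset (V × V)) (w : V) :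
    ForcedInv G S f w (G.forcedInit o w) where
  root_mem := by simp [forcedInit]
  adj := by simp [forcedInit]
  source_mem := by simp [forcedInit]
  target_mem := by simp [forcedInit]
  source_ne := by simp [forcedInit]
  existsUnique_out := by
    intro u hu hw
    simp only [forcedInit, Finset.mem_singleton] at hu
    exact absurd hu hw
  reaches := by
    intro u hu
    simp only [forcedInit, Finset.mem_singleton] at hu
    rw [hu]
  mem_forest := by simp [forcedInit]
  notMem_list := by simp [forcedInit]
  list_adj := by
    intro e he
    simp only [forcedInit, mem_edgesInto, mem_edgeSet] at he
    exact he.1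
  list_source_ne := by
    intro e he h
    simp only [forcedInit, mem_edgesInto, mem_edgeSet] at he
    rw [h, he.2] at he
    exact hloop w he.1
  list_target_mem := by
    intro e he
    simp only [forcedInit, mem_edgesInto, mem_edgeSet] at he ⊢
    simp [he.2]
  F_adj := by
    intro e he
    simp only [forcedInit, Finset.mem_filter, mem_edgeSet] at he
    exact he.1
  F_source_ne := by
    intro e he
    simp only [forcedInit, Finset.mem_filter, mem_edgeSet] at he
    exact he.2
  live_list := by
    intro u _ _ t _ h ht
    simp only [forcedInit, mem_edgesInto, mem_edgeSet, Finset.mem_singleton] at ht ⊢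
    exact ⟨h, ht⟩
  live_F := by
    intro u _ hu t _ h _
    simp only [forcedInit, Finset.mem_filter, mem_edgeSet, Finset.mem_singleton] at hu ⊢
    exact ⟨h, hu⟩
  queue := by
    refine List.pairwise_iff_forall_sublist.mpr fun {e g} hsub h => ?_
    have he : e ∈ (G.forcedInit o w).1.L := hsub.subset (by simp)
    simp only [forcedInit, mem_edgesInto, mem_edgeSet, Finset.mem_singleton] at he h
    rw [h, he.2] at he
    exact absurd he.1 (hloop w)

theorem ForcedInv.source_notMem {V : Type*} {G : Digraph V} {S : Finset V} {f : Finset (V × V)}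
    {w : V} {p : ExploreState V × Finset (V × V)} (hf : G.IsForest S f)
    (hp : ForcedInv G S f w p) {e : V × V} (he : e ∈ p.1.L)
    (hc : e ∈ f ∨ (e.1 ∈ S ∧ e.1 ∉ p.1.A)) : e.1 ∉ p.1.A := by
  intro hA
  rcases hc with hc | hc
  · obtain ⟨t, ht, -⟩ := hp.existsUnique_out e.1 hA (hp.list_source_ne e he)
    have heS := hf.source_notMem e hc
    have : t = e.2 := (hf.existsUnique_out e.1 heS).unique (hp.mem_forest _ ht heS) hc
    rw [this] at ht
    exact hp.notMem_list e ht he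
  · exact hc.2 hA

theorem ForcedInv.forcedStep {V : Type*} [Fintype V] [DecidableEq V] {G : Digraph V}
    (hloop : ∀ v, ¬ G.Adj v v) (o : LinearOrder V) {S : Finset V} {f : Finset (V × V)} {w : V}
    (hf : G.IsForest S f) {p : ExploreState V × Finset (V × V)} (hp : ForcedInv G S f w p) :
    ForcedInv G S f w (forcedStep o S f p) := by
  have hnot := fun (e : V × V) (he : e ∈ p.1.L) => hp.source_notMem hf he
  obtain ⟨⟨A, L, F⟩, T⟩ := p
  cases L with
  | nil => exact hp
  | cons e l =>
    have heL : e ∈ e :: l := List.mem_cons_self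
    by_cases hc : e ∈ f ∨ (e.1 ∈ S ∧ e.1 ∉ A)
    · have heA : e.1 ∉ A := hnot e heL hc
      have heT : ∀ g ∈ T, g.1 ≠ e.1 := fun g hg h => heA (h ▸ hp.source_mem g hg)
      simp only [Digraph.forcedStep, hc, if_true]
      have hmemL : ∀ g : V × V, g ∈ (e :: l).filter (fun g => g.1 ≠ e.1) ++ edgesInto o F e.1 ↔
          (g ∈ e :: l ∧ g.1 ≠ e.1) ∨ (g ∈ F ∧ g.2 = e.1) := by
        intro g
        rw [List.mem_append, mem_edgesInto, List.mem_filter, decide_eq_true_iff]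
      refine ⟨?_, ?_, ?_, ?_, ?_, ?_, ?_, ?_, ?_, ?_, ?_, ?_, hp.F_adj, hp.F_source_ne, ?_, ?_, ?_⟩
        <;> simp only [hmemL, Finset.mem_insert]
      · exact Or.inr hp.root_mem
      · rintro g (rfl | hg)
        · exact hp.list_adj g heL
        · exact hp.adj g hg
      · rintro g (rfl | hg)
        · exact Or.inl rfl
        · exact Or.inr (hp.source_mem g hg)
      · rintro g (rfl | hg)
        · exact Or.inr (hp.list_target_mem g heL)
        · exact Or.inr (hp.target_mem g hg)
      · rintro g (rfl | hg)
        · exact hp.list_source_ne g heL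
        · exact hp.source_ne g hg
      · rintro u (rfl | hu) huw
        · refine ⟨e.2, Or.inl rfl, ?_⟩
          rintro t (ht | ht)
          · rw [← ht]
          · exact absurd rfl (heT (e.1, t) ht)
        · obtain ⟨t, ht, htu⟩ := hp.existsUnique_out u hu huw
          refine ⟨t, Or.inr ht, ?_⟩
          rintro t' (ht' | ht')
          · exact absurd (by rw [← ht']; exact hu) heA
          · exact htu t' ht'
      · have hold : ∀ u ∈ A, Relation.ReflTransGen (fun u v => (u, v) = e ∨ (u, v) ∈ T) u w :=
          fun u hu => Relation.ReflTransGen.mono (fun _ _ h => Or.inr h) _ _ (hp.reaches u hu)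
        rintro u (rfl | hu)
        · exact .head (Or.inl rfl) (hold _ (hp.list_target_mem e heL))
        · exact hold u hu
      · rintro g (rfl | hg) hgS
        · exact hc.resolve_right fun h => hgS h.1
        · exact hp.mem_forest g hg hgS
      · rintro g (rfl | hg)
        · rintro (⟨-, h⟩ | ⟨-, h⟩)
          · exact h rfl
          · exact heA (h ▸ hp.list_target_mem g heL)
        · rintro (⟨h, -⟩ | ⟨-, h⟩)
          · exact hp.notMem_list g hg h
          · exact heA (h ▸ hp.target_mem g hg)
      · rintro g (⟨h, -⟩ | ⟨h, -⟩)
        · exact hp.list_adj g h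
        · exact hp.F_adj g h
      · rintro g (⟨h, -⟩ | ⟨h, -⟩)
        · exact hp.list_source_ne g h
        · exact hp.F_source_ne g h
      · rintro g (⟨h, -⟩ | ⟨-, h⟩)
        · exact Or.inr (hp.list_target_mem g h)
        · exact Or.inl h
      · intro u huS hu t htS hut ht
        push Not at hu
        by_cases htA : t ∈ A
        · exact Or.inl ⟨hp.live_list u huS hu.2 t htS hut htA, hu.1⟩
        · exact Or.inr ⟨hp.live_F u huS hu.2 t htS hut htA, ht.resolve_right htA⟩
      · intro u huS hu t htS hut ht
        push Not at hu ht
        exact hp.live_F u huS hu.2 t htS hut ht.2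
      · rw [List.pairwise_append]
        refine ⟨?_, ?_, ?_⟩
        · rw [List.pairwise_filter]
          refine hp.queue.imp fun {g h} hgh hg _ hgA => ?_
          exact hgh (hgA.resolve_left (by simpa using hg))
        · refine List.pairwise_iff_forall_sublist.mpr fun {g h} hsub _ hgh => ?_
          have hg : g ∈ edgesInto o F e.1 := hsub.subset (by simp)
          have hh : h ∈ edgesInto o F e.1 := hsub.subset (by simp)
          rw [mem_edgesInto] at hg hh
          have hadj := hp.F_adj g hg.1
          rw [← hgh, hh.2, hg.2] at hadj
          exact hloop _ hadj
        · intro g hg h hh _ hgh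
          rw [mem_edgesInto] at hh
          rw [List.mem_filter, decide_eq_true_iff] at hg
          exact hg.2 (hgh ▸ hh.2)
    · simp only [Digraph.forcedStep, hc, if_false]
      have hmemL : ∀ g : V × V, g ∈ (e :: l).filter (fun g => g.1 ≠ e.1 ∧ g.2 ≠ e.1) ↔
          g ∈ e :: l ∧ g.1 ≠ e.1 ∧ g.2 ≠ e.1 := by
        intro g
        rw [List.mem_filter, decide_eq_true_iff]
      push Not at hc
      refine ⟨hp.root_mem, hp.adj, hp.source_mem, hp.target_mem, hp.source_ne,
        hp.existsUnique_out, hp.reaches, hp.mem_forest, ?_, ?_, ?_, ?_, ?_, ?_, ?_, ?_,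
        List.Pairwise.filter _ hp.queue⟩ <;> simp only [hmemL, Finset.mem_filter]
      · exact fun g hg h => hp.notMem_list g hg h.1
      · exact fun g hg => hp.list_adj g hg.1
      · exact fun g hg => hp.list_source_ne g hg.1
      · exact fun g hg => hp.list_target_mem g hg.1
      · exact fun g hg => hp.F_adj g hg.1
      · exact fun g hg => hp.F_source_ne g hg.1
      · intro u huS hu t htS hut htA
        have hL := hp.live_list u huS hu t htS hut htA
        have hue : u ≠ e.1 := fun h => hu (h ▸ hc.2 (h ▸ huS))
        refine ⟨hL, hue, fun hte => ?_⟩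
        -- The erased vertex `t` is explored, so that the queue contains no edge with target `t`.
        rcases List.mem_cons.mp hL with h | h
        · exact hue (congrArg Prod.fst h)
        · exact (List.pairwise_cons.mp hp.queue).1 _ h (hte ▸ htA) hte
      · intro u huS hu t htS hut htA
        refine ⟨hp.live_F u huS hu t htS hut htA, fun h => hu (h ▸ hc.2 (h ▸ huS)), fun h => ?_⟩
        exact htA (h ▸ hc.2 (h ▸ htS))

/-- The measure `exploreFuel` decreases in the forced exploration too, so that it terminates. -/
theorem ForcedInv.exploreFuel_forcedStep {V : Type*} [Fintype V] [DecidableEq V] {G : Digraph V}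
    (o : LinearOrder V) {S : Finset V} {f : Finset (V × V)} {w : V}
    (hf : G.IsForest S f) {p : ExploreState V × Finset (V × V)} (hp : ForcedInv G S f w p)
    (hL : p.1.L ≠ []) :
    G.exploreFuel (Digraph.forcedStep o S f p).1 < G.exploreFuel p.1 := by
  have hnot := fun (e : V × V) (he : e ∈ p.1.L) => hp.source_notMem hf he
  obtain ⟨⟨A, L, F⟩, T⟩ := p
  cases L with
  | nil => exact absurd rfl hL
  | cons e l =>
    by_cases hc : e ∈ f ∨ (e.1 ∈ S ∧ e.1 ∉ A)
    · have heA : e.1 ∉ A := hnot e List.mem_cons_self hc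
      simp only [Digraph.forcedStep, hc, if_true]
      simp only [exploreFuel, List.length_append, length_edgesInto]
      have c1 : ((e :: l).filter (fun f => decide (f.1 ≠ e.1))).length < (e :: l).length := by
        rw [List.filter_cons_of_neg (by simp)]
        exact Nat.lt_succ_of_le (List.length_filter_le _ _)
      have c2 : (F.filter (fun f => f.2 = e.1)).card
          + (G.edgeSet.filter (fun f => f.2 ∉ insert e.1 A)).card
          ≤ (G.edgeSet.filter (fun f => f.2 ∉ A)).card := by
        rw [← Finset.card_union_of_disjoint]
        · apply Finset.card_le_card
          intro g hg
          simp only [Finset.mem_union, Finset.mem_filter, Finset.mem_insert, not_or] at hg ⊢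
          rcases hg with hg | hg
          · exact ⟨mem_edgeSet.mpr (hp.F_adj g hg.1), hg.2 ▸ heA⟩
          · exact ⟨hg.1, hg.2.2⟩
        · rw [Finset.disjoint_left]
          intro g hg hg'
          simp only [Finset.mem_filter, Finset.mem_insert, not_or] at hg hg'
          exact hg'.2.1 hg.2
      omega
    · simp only [Digraph.forcedStep, hc, if_false, exploreFuel]
      rw [List.filter_cons_of_neg (by simp)]
      have := List.length_filter_le (fun f => decide (f.1 ≠ e.1 ∧ f.2 ≠ e.1)) l
      simp only [List.length_cons]
      omega

theorem forcedInv_iterate {V : Type*} [Fintype V] [DecidableEq V] {G : Digraph V}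
    (hloop : ∀ v, ¬ G.Adj v v) (o : LinearOrder V) {S : Finset V} {f : Finset (V × V)} (w : V)
    (hf : G.IsForest S f) (n : ℕ) :
    ForcedInv G S f w ((forcedStep o S f)^[n] (G.forcedInit o w)) := by
  induction n with
  | zero => exact forcedInv_forcedInit hloop o S f w
  | succ n ih =>
    rw [Function.iterate_succ_apply']
    exact ih.forcedStep hloop o hf

theorem forced_list_eq_nil {V : Type*} [Fintype V] [DecidableEq V] {G : Digraph V}
    (hloop : ∀ v, ¬ G.Adj v v) (o : LinearOrder V) {S : Finset V} {f : Finset (V × V)} (w : V)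
    (hf : G.IsForest S f) :
    ((forcedStep o S f)^[G.edgeSet.card] (G.forcedInit o w)).1.L = [] := by
  have key : ∀ n (p : ExploreState V × Finset (V × V)), ForcedInv G S f w p →
      G.exploreFuel p.1 ≤ n → ((forcedStep o S f)^[n] p).1.L = [] := by
    intro n
    induction n with
    | zero =>
      intro p _ hn
      simp only [exploreFuel] at hn
      exact List.length_eq_zero_iff.mp (by simpa using (by omega : p.1.L.length = 0))
    | succ n ih =>
      intro p hp hn
      by_cases hL : p.1.L = []
      · have hfix : forcedStep o S f p = p := by
          rw [forcedStep, hL]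
        rw [Function.iterate_fixed hfix, hL]
      · rw [Function.iterate_succ_apply]
        have := hp.exploreFuel_forcedStep o hf hL
        exact ih _ (hp.forcedStep hloop o hf) (by omega)
  refine key _ _ (forcedInv_forcedInit hloop o S f w) ?_
  simp only [forcedInit, exploreFuel, length_edgesInto, Finset.mem_singleton]
  exact (Finset.card_filter_add_card_filter_not _).le

theorem forced_tree_mono {V : Type*} [Fintype V] [DecidableEq V] {G : Digraph V}
    (o : LinearOrder V) {S : Finset V} {f : Finset (V × V)} (w : V) :
    Monotone fun n => ((forcedStep o S f)^[n] (G.forcedInit o w)).2 := by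
  refine monotone_nat_of_le_succ fun n => ?_
  simp only [Function.iterate_succ_apply']
  generalize (forcedStep o S f)^[n] (G.forcedInit o w) = p
  unfold forcedStep
  split
  · exact le_rfl
  · split
    · exact Finset.subset_insert _ _
    · exact le_rfl

/-- If `S` is strongly connected then the forced exploration explores all of `S`. -/
theorem subset_forced {V : Type*} [Fintype V] [DecidableEq V] {G : Digraph V}
    (hloop : ∀ v, ¬ G.Adj v v) (o : LinearOrder V) {S : Finset V} {f : Finset (V × V)} {w : V}
    (hf : G.IsForest S f) (hS : G.StronglyConnectedOn S) (hw : w ∈ S) :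
    S ⊆ ((forcedStep o S f)^[G.edgeSet.card] (G.forcedInit o w)).1.A := by
  have hL := forced_list_eq_nil hloop o w hf
  have hp := forcedInv_iterate hloop o w hf G.edgeSet.card
  generalize (forcedStep o S f)^[G.edgeSet.card] (G.forcedInit o w) = p at *
  intro u hu
  induction hS u hu w hw using Relation.ReflTransGen.head_induction_on with
  | refl => exact hp.root_mem
  | @head x y hxy _ ih =>
    by_contra hx
    have := hp.live_list x hxy.1 hx y hxy.2.1 hxy.2.2 (ih hxy.2.1)
    rw [hL] at this
    exact List.not_mem_nil this

/-- Every spanning forest whose set of roots `S` is strongly connected is the part outside `S` of a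
tree that explores `S`, with any prescribed root in `S`. -/
theorem exists_outside_eq {V : Type*} [Fintype V] [DecidableEq V] {G : Digraph V}
    (hloop : ∀ v, ¬ G.Adj v v) (o : LinearOrder V) {S : Finset V} {f : Finset (V × V)} {w : V}
    (hf : G.IsForest S f) (hS : G.StronglyConnectedOn S) (hw : w ∈ S) :
    ∃ a : G.SpanningTree, a.root = w ∧ a.outside S = f ∧ S ⊆ G.explored o a := by
  have hsub := subset_forced hloop o hf hS hw
  have hp := forcedInv_iterate hloop o w hf G.edgeSet.card
  set p := (forcedStep o S f)^[G.edgeSet.card] (G.forcedInit o w) with hpdef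
  have hreachS : ∀ u ∈ S, Relation.ReflTransGen (fun u v => (u, v) ∈ f ∪ p.2) u w := fun u hu =>
    Relation.ReflTransGen.mono (fun _ _ h => Finset.mem_union_right _ h) _ _
      (hp.reaches u (hsub hu))
  have hin : ∀ e : V × V, e.1 ∈ S → (e ∈ f ∪ p.2 ↔ e ∈ p.2) := by
    intro e he
    rw [Finset.mem_union, or_iff_right fun h => hf.source_notMem e h he]
  have hout : ∀ e : V × V, e.1 ∉ S → (e ∈ f ∪ p.2 ↔ e ∈ f) := by
    intro e he
    rw [Finset.mem_union, or_iff_left_of_imp fun h => hp.mem_forest e h he]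
  let a : G.SpanningTree := SpanningTree.ofReflTransGen (f ∪ p.2) w
    (by
      intro e he
      rcases Finset.mem_union.mp he with he | he
      · exact hf.adj e he
      · exact hp.adj e he)
    (by
      intro t
      rw [hin _ hw]
      exact fun h => hp.source_ne _ h rfl)
    (by
      intro u hu
      by_cases huS : u ∈ S
      · simpa only [hin (u, _) huS] using hp.existsUnique_out u (hsub huS) hu
      · simpa only [hout (u, _) huS] using hf.existsUnique_out u huS)
    (by
      intro u
      obtain ⟨s, hs, h⟩ := hf.reaches u
      exact (Relation.ReflTransGen.mono (fun _ _ h => Finset.mem_union_left _ h) _ _ h).trans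
        (hreachS s hs))
  have haedges : a.edges = f ∪ p.2 := rfl
  have haroot : a.root = w := rfl
  refine ⟨a, haroot, ?_, ?_⟩
  · ext e
    rw [SpanningTree.mem_outside, haedges]
    by_cases he : e.1 ∈ S
    · exact iff_of_false (fun h => h.2 he) fun h => hf.source_notMem e h he
    · rw [hout e he, and_iff_left he]
  · -- The exploration of `a` goes through the states of the forced exploration.
    have hrun : ∀ n ≤ G.edgeSet.card, (G.exploreStep o a)^[n] (G.exploreInit o a)
        = ((forcedStep o S f)^[n] (G.forcedInit o w)).1 := by
      intro n
      induction n with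
      | zero => exact fun _ => rfl
      | succ n ih =>
        intro hn
        have hpn := forcedInv_iterate hloop o w hf n
        have hmn := forced_tree_mono (G := G) o (S := S) (f := f) w (Nat.le_of_succ_le hn)
        have hmn' := forced_tree_mono (G := G) o (S := S) (f := f) w hn
        simp only [Function.iterate_succ_apply', ih (by omega), ← hpdef] at hmn hmn' ⊢
        generalize (forcedStep o S f)^[n] (G.forcedInit o w) = q at *
        obtain ⟨⟨A, L, F⟩, T⟩ := q
        cases L with
        | nil => rfl
        | cons e l =>
          have heL : e ∈ e :: l := List.mem_cons_self
          have hiff : e ∈ a.edges ↔ e ∈ f ∨ (e.1 ∈ S ∧ e.1 ∉ A) := by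
            constructor
            · intro he
              by_cases heS : e.1 ∈ S
              · refine Or.inr ⟨heS, fun heA => ?_⟩
                have hne := hpn.list_source_ne e heL
                obtain ⟨t, ht, -⟩ := hpn.existsUnique_out e.1 heA hne
                have : t = e.2 := (hp.existsUnique_out e.1 (hsub heS) hne).unique (hmn ht)
                  ((hin e heS).mp he)
                rw [this] at ht
                exact hpn.notMem_list e ht heL
              · exact Or.inl ((hout e heS).mp he)
            · intro hc
              simp only [forcedStep, hc, if_true] at hmn'
              exact Finset.mem_union_right _ (hmn' (Finset.mem_insert_self _ _))
          by_cases hc : e ∈ f ∨ (e.1 ∈ S ∧ e.1 ∉ A)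
          · have hea := hiff.mpr hc
            simp only [exploreStep, forcedStep, hea, hc, if_true]
          · have hea : e ∉ a.edges := mt hiff.mp hc
            simp only [exploreStep, forcedStep, hea, hc, if_false]
    rw [explored, exploreFinal, hrun _ le_rfl]
    exact hsub

/-- The number of trees that have root `w` and explore the strongly connected set `S ∋ w` is the
number of spanning forests with set of roots `S`, for every `w` and every total order. -/
theorem card_subset_explored {V : Type*} [Fintype V] [DecidableEq V] {G : Digraph V}
    (hloop : ∀ v, ¬ G.Adj v v) (o : LinearOrder V) {S : Finset V} {w : V}
    (hS : G.StronglyConnectedOn S) (hw : w ∈ S) :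
    (Finset.univ.filter (fun a : G.SpanningTree => a.root = w ∧ S ⊆ G.explored o a)).card
      = (G.forests S).card := by
  refine Finset.card_bij (fun a _ => a.outside S) ?_ ?_ ?_
  · intro a ha
    simp only [Finset.mem_filter, Finset.mem_univ, true_and, forests] at ha ⊢
    exact a.isForest_outside (ha.1.symm ▸ hw)
  · intro a ha b hb h
    simp only [Finset.mem_filter, Finset.mem_univ, true_and] at ha hb
    exact eq_of_outside_eq_of_subset_explored (ha.1.trans hb.1.symm) ha.2 hb.2 h
  · intro f hf
    simp only [Finset.mem_filter, Finset.mem_univ, true_and, forests] at hf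
    obtain ⟨a, h1, h2, h3⟩ := exists_outside_eq hloop o hf hS hw
    exact ⟨a, by simp [h1, h3], h2⟩

/-! ### Multiplicities -/

theorem mem_psi {V : Type*} [Fintype V] [DecidableEq V] {G : Digraph V} {o : LinearOrder V}
    {a : G.SpanningTree} {u : V} :
    u ∈ G.psi o a ↔ u ∈ G.explored o a ∧ G.Reaches (G.explored o a) a.root u ∧
      G.Reaches (G.explored o a) u a.root := by
  simp [psi]

theorem Reaches.mono {V : Type*} {G : Digraph V} {S W : Finset V} (h : S ⊆ W) {u v : V}
    (huv : G.Reaches S u v) : G.Reaches W u v :=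
  Relation.ReflTransGen.mono (fun _ _ hxy => ⟨h hxy.1, h hxy.2.1, hxy.2.2⟩) _ _ huv

theorem stronglyConnectedOn_psi {V : Type*} [Fintype V] [DecidableEq V] (G : Digraph V)
    (o : LinearOrder V) (a : G.SpanningTree) : G.StronglyConnectedOn (G.psi o a) := by
  have hto : ∀ u, G.Reaches (G.explored o a) u a.root → G.Reaches (G.explored o a) a.root u →
      G.Reaches (G.psi o a) u a.root := by
    intro u hu
    induction hu using Relation.ReflTransGen.head_induction_on with
    | refl => exact fun _ => .refl
    | @head x y hxy hy ih =>
      intro hx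
      have hy' := hx.tail hxy
      exact .head ⟨mem_psi.mpr ⟨hxy.1, hx, .head hxy hy⟩, mem_psi.mpr ⟨hxy.2.1, hy', hy⟩, hxy.2.2⟩
        (ih hy')
  have hfrom : ∀ u, G.Reaches (G.explored o a) a.root u → G.Reaches (G.explored o a) u a.root →
      G.Reaches (G.psi o a) a.root u := by
    intro u hu
    induction hu with
    | refl => exact fun _ => .refl
    | @tail x y hx hxy ih =>
      intro hy
      have hx' : G.Reaches (G.explored o a) x a.root := .head hxy hy
      exact .tail (ih hx') ⟨mem_psi.mpr ⟨hxy.1, hx, hx'⟩, mem_psi.mpr ⟨hxy.2.1, hx.tail hxy, hy⟩,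
        hxy.2.2⟩
  intro u hu v hv
  obtain ⟨-, hu1, hu2⟩ := mem_psi.mp hu
  obtain ⟨-, hv1, hv2⟩ := mem_psi.mp hv
  exact (hto u hu2 hu1).trans (hfrom v hv1 hv2)

theorem subset_psi_iff {V : Type*} [Fintype V] [DecidableEq V] {G : Digraph V}
    {o : LinearOrder V} {a : G.SpanningTree} {S : Finset V} (hS : G.StronglyConnectedOn S)
    (ha : a.root ∈ S) : S ⊆ G.psi o a ↔ S ⊆ G.explored o a :=
  ⟨fun h _ hu => (mem_psi.mp (h hu)).1, fun h _ hu =>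
    mem_psi.mpr ⟨h hu, (hS _ ha _ hu).mono h, (hS _ hu _ ha).mono h⟩⟩

theorem mem_stronglyConnectedSubsets {V : Type*} [Fintype V] {G : Digraph V} {W : Finset V} :
    W ∈ G.stronglyConnectedSubsets ↔ G.StronglyConnectedOn W := by
  simp [stronglyConnectedSubsets]

/-- The equations that determine the multiplicities, by descending induction on `S`: the right-hand
side depends neither on `w` nor on `o`. -/
theorem sum_multiplicity {V : Type*} [Fintype V] [DecidableEq V] {G : Digraph V}
    (hloop : ∀ v, ¬ G.Adj v v) (o : LinearOrder V) {S : Finset V} {w : V}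
    (hS : G.StronglyConnectedOn S) (hw : w ∈ S) :
    ∑ W ∈ G.stronglyConnectedSubsets with S ⊆ W, G.multiplicity o W w = (G.forests S).card := by
  rw [← card_subset_explored hloop o hS hw]
  rw [Finset.card_eq_sum_card_fiberwise (f := G.psi o)
    (t := G.stronglyConnectedSubsets.filter (S ⊆ ·))]
  · refine Finset.sum_congr rfl fun W hW => ?_
    rw [multiplicity]
    congr 1
    ext a
    simp only [Finset.mem_filter, Finset.mem_univ, true_and] at hW ⊢
    constructor
    · rintro ⟨h1, h2⟩
      refine ⟨⟨h1, ?_⟩, h2⟩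
      rw [← subset_psi_iff hS (h1 ▸ hw), h2]
      exact hW.2
    · rintro ⟨⟨h1, -⟩, h2⟩
      exact ⟨h1, h2⟩
  · intro a ha
    simp only [Finset.coe_filter, Finset.mem_univ, true_and, Set.mem_ofPred_eq] at ha ⊢
    exact ⟨mem_stronglyConnectedSubsets.mpr (G.stronglyConnectedOn_psi o a),
      (subset_psi_iff hS (ha.1 ▸ hw)).mpr ha.2⟩

theorem multiplicity_eq {V : Type*} [Fintype V] [DecidableEq V] {G : Digraph V}
    (hloop : ∀ v, ¬ G.Adj v v) (o o' : LinearOrder V) {W : Finset V} {w w' : V}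
    (hW : G.StronglyConnectedOn W) (hw : w ∈ W) (hw' : w' ∈ W) :
    G.multiplicity o W w = G.multiplicity o' W w' := by
  induction hn : Fintype.card V - W.card using Nat.strong_induction_on generalizing W with
  | _ n ih =>
    have hmem : W ∈ G.stronglyConnectedSubsets.filter (W ⊆ ·) :=
      Finset.mem_filter.mpr ⟨mem_stronglyConnectedSubsets.mpr hW, subset_rfl⟩
    have h1 := sum_multiplicity hloop o hW hw
    have h2 := sum_multiplicity hloop o' hW hw'
    rw [← Finset.add_sum_erase _ _ hmem] at h1 h2
    have h3 : ∑ U ∈ (G.stronglyConnectedSubsets.filter (W ⊆ ·)).erase W, G.multiplicity o U w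
        = ∑ U ∈ (G.stronglyConnectedSubsets.filter (W ⊆ ·)).erase W, G.multiplicity o' U w' := by
      refine Finset.sum_congr rfl fun U hU => ?_
      obtain ⟨hne, hU⟩ := Finset.mem_erase.mp hU
      obtain ⟨hUsc, hWU⟩ := Finset.mem_filter.mp hU
      have hss : W ⊂ U := hWU.ssubset_of_ne hne.symm
      refine ih _ ?_ (mem_stronglyConnectedSubsets.mp hUsc) (hWU hw) (hWU hw') rfl
      have := Finset.card_lt_card hss
      have := Finset.card_le_univ U
      omega
    omega

/-! ### Walks and powers of matrices -/

/-- The lists of length `k` of elements of `V`. -/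
def words (V : Type*) [Fintype V] [DecidableEq V] : ℕ → Finset (List V)
  | 0 => {[]}
  | k + 1 => (Finset.univ ×ˢ words V k).image (fun p => p.1 :: p.2)

theorem sum_words_succ {V R : Type*} [Fintype V] [DecidableEq V] [AddCommMonoid R] (k : ℕ)
    (F : List V → R) :
    ∑ l ∈ words V (k + 1), F l = ∑ v, ∑ l ∈ words V k, F (v :: l) := by
  rw [words, Finset.sum_image (by rintro ⟨_, _⟩ _ ⟨_, _⟩ _ h; simpa using h), Finset.sum_product]

/-- The product of the entries of `M` along the walk that starts at `u` and visits the vertices of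
the list in turn. -/
def walkWeight {V R : Type*} [CommRing R] (M : Matrix V V R) : V → List V → R
  | _, [] => 1
  | u, v :: l => M u v * walkWeight M v l

/-- The last vertex of the walk that starts at `u` and visits the vertices of the list in turn. -/
def walkEnd {V : Type*} : V → List V → V
  | u, [] => u
  | _, v :: l => walkEnd v l

theorem submatrix_pow_apply {V R : Type*} [Fintype V] [DecidableEq V] [CommRing R]
    (M : Matrix V V R) (W : Finset V) (k : ℕ) (u v : W) :
    ((M.submatrix Subtype.val Subtype.val : Matrix W W R) ^ k) u v
      = ∑ l ∈ words V k, if (∀ x ∈ l, x ∈ W) ∧ walkEnd u.1 l = v then walkWeight M u l else 0 := by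
  induction k generalizing u with
  | zero =>
    simp only [pow_zero, words, Finset.sum_singleton, walkEnd, walkWeight, Matrix.one_apply,
      Subtype.ext_iff]
    simp
  | succ k ih =>
    rw [pow_succ', Matrix.mul_apply, sum_words_succ]
    have h : ∀ x : V, (∑ l ∈ words V k, if (∀ z ∈ x :: l, z ∈ W) ∧ walkEnd u.1 (x :: l) = v
        then walkWeight M u (x :: l) else 0) = if hx : x ∈ W then M u x *
          ((M.submatrix Subtype.val Subtype.val : Matrix W W R) ^ k) ⟨x, hx⟩ v else 0 := by
      intro x
      split_ifs with hx
      · rw [ih, Finset.mul_sum]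
        refine Finset.sum_congr rfl fun l _ => ?_
        simp only [List.forall_mem_cons, hx, true_and, walkEnd, walkWeight, mul_ite, mul_zero]
      · simp [hx]
    simp only [h]
    rw [← Finset.sum_subset (Finset.subset_univ W) (fun x _ hx => by simp [hx]),
      ← Finset.sum_coe_sort W]
    refine Finset.sum_congr rfl fun x _ => ?_
    simp

/-! ### Walks in the tree graph -/

/-- The spanning tree obtained from `a` by moving the root along the edge from `a.root` to `v`; it
is `a` itself when there is no such edge, in particular for `v = a.root`. -/
def SpanningTree.move {V : Type*} [Finite V] [DecidableEq V] {G : Digraph V} (a : G.SpanningTree)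
    (v : V) : G.SpanningTree :=
  open Classical in
  if h : G.Adj a.root v ∧ a.root ≠ v then
    SpanningTree.ofReflTransGen ((insert (a.root, v) a.edges).filter (fun f => f.1 ≠ v)) v
      (by
        intro e he
        simp only [Finset.mem_filter, Finset.mem_insert] at he
        rcases he with ⟨rfl | he, -⟩
        · exact h.1
        · exact a.adj_of_mem e he)
      (by simp)
      (by
        intro u hu
        simp only [Finset.mem_filter, Finset.mem_insert, Prod.mk.injEq, hu, ne_eq,
          not_false_eq_true, and_true]
        by_cases hr : u = a.root
        · subst hr
          exact ⟨v, Or.inl ⟨rfl, rfl⟩, fun t ht => ht.elim (·.2) fun ht =>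
            absurd ht (a.root_out t)⟩
        · simpa [hr] using a.existsUnique_out u hr)
      (by
        intro u
        induction a.reflTransGen_root u using Relation.ReflTransGen.head_induction_on with
        | refl => exact .single (by simp [h.2])
        | @head x y hxy _ ih =>
          by_cases hx : x = v
          · rw [hx]
          · exact .head (by simp [hx, hxy]) ih)
  else a

theorem SpanningTree.root_move {V : Type*} [Finite V] [DecidableEq V] {G : Digraph V}
    {a : G.SpanningTree} {v : V} (h : G.Adj a.root v ∨ a.root = v) : (a.move v).root = v := by
  unfold move
  split_ifs with h'
  · rfl
  · tauto

theorem SpanningTree.edges_move {V : Type*} [Finite V] [DecidableEq V] {G : Digraph V}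
    {a : G.SpanningTree} {v : V} (h : G.Adj a.root v ∨ a.root = v) :
    (a.move v).edges = (insert (a.root, v) a.edges).filter (fun f => f.1 ≠ v) := by
  unfold move
  split_ifs with h'
  · rfl
  · have hv : a.root = v := by tauto
    ext ⟨x, y⟩
    simp only [Finset.mem_filter, Finset.mem_insert, Prod.mk.injEq, ne_eq, ← hv]
    constructor
    · exact fun hx => ⟨Or.inr hx, fun hr => a.root_out y (hr ▸ hx)⟩
    · rintro ⟨⟨hx, -⟩ | hx, hr⟩
      · exact absurd hx hr
      · exact hx

theorem SpanningTree.move_eq_self {V : Type*} [Finite V] [DecidableEq V] {G : Digraph V}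
    {a : G.SpanningTree} {v : V} (h : ¬ (G.Adj a.root v ∧ a.root ≠ v)) : a.move v = a :=
  dif_neg h

theorem treeGraph_adj_iff {V : Type*} [Finite V] [DecidableEq V] {G : Digraph V}
    {a b : G.SpanningTree} :
    G.treeGraph.Adj a b ↔ G.Adj a.root b.root ∧ a.move b.root = b := by
  refine and_congr_right fun h => ?_
  rw [SpanningTree.ext_iff, SpanningTree.edges_move (Or.inl h),
    SpanningTree.root_move (Or.inl h), and_iff_left rfl, eq_comm]

/-- Each entry of the lifted operator is a sum of entries of the row of `G.schrodinger` at the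
root. -/
theorem liftedSchrodinger_apply {V : Type*} [Fintype V] [DecidableEq V] {G : Digraph V}
    (a b : G.SpanningTree) :
    G.liftedSchrodinger a b = ∑ v, if a.move v = b then G.schrodinger a.root v else 0 := by
  have hroot : a.move a.root = a := SpanningTree.move_eq_self (by simp)
  have hoff : ∀ b, b ≠ a → G.treeEdgeWeight a b
      = ∑ v, if a.move v = b then G.edgeWeight a.root v else 0 := by
    intro b hb
    rw [Finset.sum_eq_single b.root]
    · by_cases h : G.Adj a.root b.root
      · simp [treeEdgeWeight, treeGraph_adj_iff, h]
      · simp [treeEdgeWeight, treeGraph_adj_iff, h, edgeWeight]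
    · intro v _ hv
      refine if_neg fun h => ?_
      by_cases hv' : G.Adj a.root v ∧ a.root ≠ v
      · exact hv (by rw [← h, SpanningTree.root_move (Or.inl hv'.1)])
      · exact hb (by rw [← h, SpanningTree.move_eq_self hv'])
    · simp
  by_cases hab : a = b
  · subst hab
    have hsum : ∑ b ∈ Finset.univ.erase a, G.treeEdgeWeight a b
        = ∑ v ∈ Finset.univ.erase a.root, G.edgeWeight a.root v := by
      rw [Finset.sum_congr rfl fun b hb => hoff b (Finset.ne_of_mem_erase hb), Finset.sum_comm]
      symm
      refine Finset.sum_subset_zero_on_sdiff (Finset.subset_univ _) (fun v hv => ?_)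
        (fun v hv => ?_)
      · have : v = a.root := by simpa using hv
        subst this
        simp [hroot]
      · by_cases h : a.move v = a
        · have : ¬ G.Adj a.root v := fun h' => Finset.ne_of_mem_erase hv
            (by rw [← SpanningTree.root_move (Or.inl h'), h])
          simp [edgeWeight, this]
        · simp [h]
    rw [Finset.sum_eq_single a.root]
    · simp only [hroot, liftedSchrodinger, schrodinger, weightedSchrodinger, Matrix.add_apply,
        Matrix.of_apply, if_true, Matrix.diagonal_apply_eq, hsum]
    · intro v _ hv
      split_ifs with h
      · have : ¬ G.Adj a.root v := fun h' => hv (by rw [← SpanningTree.root_move (Or.inl h'), h])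
        simp [schrodinger, weightedSchrodinger, edgeWeight, this, hv.symm]
      · rfl
    · simp
  · have h1 : G.liftedSchrodinger a b = G.treeEdgeWeight a b := by
      simp [liftedSchrodinger, weightedSchrodinger, hab]
    rw [h1, hoff b (Ne.symm hab)]
    refine Finset.sum_congr rfl fun v _ => ?_
    split_ifs with h
    · have hv : a.root ≠ v := fun h' => hab (by rw [← h, ← h', hroot])
      simp [schrodinger, weightedSchrodinger, hv]
    · rfl

theorem adj_or_eq_of_schrodinger_ne_zero {V : Type*} [Fintype V] [DecidableEq V] {G : Digraph V}
    {u v : V} (h : G.schrodinger u v ≠ 0) : G.Adj u v ∨ u = v := by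
  by_contra hc
  push Not at hc
  exact h (by simp [schrodinger, weightedSchrodinger, edgeWeight, hc.1, hc.2])

/-- The end of the walk in the tree graph that starts at `a` and lifts the walk that starts at
`a.root` and visits the vertices of the list in turn. -/
def SpanningTree.moves {V : Type*} [Finite V] [DecidableEq V] {G : Digraph V} :
    G.SpanningTree → List V → G.SpanningTree :=
  List.foldl SpanningTree.move

theorem liftedSchrodinger_pow_apply {V : Type*} [Fintype V] [DecidableEq V] {G : Digraph V}
    (k : ℕ) (a b : G.SpanningTree) :
    (G.liftedSchrodinger ^ k) a b
      = ∑ l ∈ words V k, if a.moves l = b then walkWeight G.schrodinger a.root l else 0 := by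
  induction k generalizing a with
  | zero =>
    rw [words, Finset.sum_singleton, pow_zero, Matrix.one_apply]
    rfl
  | succ k ih =>
    rw [pow_succ', Matrix.mul_apply, sum_words_succ]
    simp only [liftedSchrodinger_apply, Finset.sum_mul]
    rw [Finset.sum_comm]
    refine Finset.sum_congr rfl fun v _ => ?_
    rw [Finset.sum_eq_single (a.move v) (fun c _ hc => by simp [hc.symm]) (by simp), if_pos rfl,
      ih, Finset.mul_sum]
    refine Finset.sum_congr rfl fun l _ => ?_
    by_cases h : G.schrodinger a.root v = 0
    · simp [walkWeight, h]
    · rw [SpanningTree.root_move (adj_or_eq_of_schrodinger_ne_zero h)]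
      exact mul_ite_zero _ _ _

theorem isChain_of_walkWeight_ne_zero {V : Type*} [Fintype V] [DecidableEq V] {G : Digraph V}
    {u : V} {l : List V} (h : walkWeight G.schrodinger u l ≠ 0) :
    (u :: l).IsChain (fun x y => G.Adj x y ∨ x = y) := by
  induction l generalizing u with
  | nil => simp
  | cons v l ih =>
    rw [walkWeight] at h
    exact List.isChain_cons_cons.mpr ⟨adj_or_eq_of_schrodinger_ne_zero (left_ne_zero_of_mul h),
      ih (right_ne_zero_of_mul h)⟩

theorem SpanningTree.root_moves {V : Type*} [Finite V] [DecidableEq V] {G : Digraph V}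
    {a : G.SpanningTree} {l : List V}
    (h : (a.root :: l).IsChain (fun x y => G.Adj x y ∨ x = y)) :
    (a.moves l).root = walkEnd a.root l := by
  induction l generalizing a with
  | nil => rfl
  | cons v l ih =>
    rw [List.isChain_cons_cons] at h
    have hr := root_move h.1
    have := ih (a := a.move v) (hr.symm ▸ h.2)
    rw [hr] at this
    exact this

/-- A walk does not change the edges that leave the vertices it does not visit. -/
theorem SpanningTree.mem_edges_moves_of_notMem {V : Type*} [Finite V] [DecidableEq V]
    {G : Digraph V} {a : G.SpanningTree} {l : List V}
    (h : (a.root :: l).IsChain (fun x y => G.Adj x y ∨ x = y)) {e : V × V}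
    (he : e.1 ∉ a.root :: l) : e ∈ (a.moves l).edges ↔ e ∈ a.edges := by
  induction l generalizing a with
  | nil => rfl
  | cons v l ih =>
    rw [List.isChain_cons_cons] at h
    have hr := root_move h.1
    rw [List.mem_cons, not_or] at he
    have hev : e.1 ≠ v := fun h => he.2 (h ▸ List.mem_cons_self)
    refine (ih (a := a.move v) (hr.symm ▸ h.2) (hr.symm ▸ he.2)).trans ?_
    rw [edges_move h.1, Finset.mem_filter, Finset.mem_insert, and_iff_left hev,
      or_iff_right fun h => he.1 (by rw [h])]

/-- After a walk, the edge that leaves a visited vertex is the last one that the walk took from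
there: it does not depend on the initial tree. -/
theorem SpanningTree.mem_edges_moves_of_mem {V : Type*} [Finite V] [DecidableEq V]
    {G : Digraph V} {a b : G.SpanningTree} (hab : a.root = b.root) {l : List V}
    (h : (a.root :: l).IsChain (fun x y => G.Adj x y ∨ x = y)) {e : V × V}
    (he : e.1 ∈ a.root :: l) : e ∈ (a.moves l).edges ↔ e ∈ (b.moves l).edges := by
  induction l generalizing a b with
  | nil =>
    have he : e.1 = a.root := by simpa using he
    have ha := a.root_out e.2
    have hb := b.root_out e.2
    rw [← hab] at hb
    rw [← he] at ha hb
    exact iff_of_false ha hb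
  | cons v l ih =>
    rw [List.isChain_cons_cons] at h
    have hra := root_move h.1
    have hb := h.1
    rw [hab] at hb
    have hrb := root_move hb
    have hca := h.2
    have hcb := h.2
    rw [← hra] at hca
    rw [← hrb] at hcb
    by_cases hel : e.1 ∈ v :: l
    · exact ih (hra.trans hrb.symm) hca (hra.symm ▸ hel)
    · have he : e.1 = a.root := (List.mem_cons.mp he).resolve_right hel
      refine (mem_edges_moves_of_notMem hca (hra.symm ▸ hel)).trans
        (Iff.trans ?_ (mem_edges_moves_of_notMem hcb (hrb.symm ▸ hel)).symm)
      rw [edges_move h.1, edges_move hb, ← hab]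
      have h1 := a.root_out e.2
      have h2 := b.root_out e.2
      rw [← hab] at h2
      rw [← he] at h1 h2 ⊢
      simp only [Finset.mem_filter, Finset.mem_insert]
      rw [or_iff_left h1, or_iff_left h2]

/-- The set of vertices visited by a closed walk is strongly connected. -/
theorem stronglyConnectedOn_of_isChain {V : Type*} [DecidableEq V] {G : Digraph V} {u : V}
    {l : List V} (h : (u :: l).IsChain (fun x y => G.Adj x y ∨ x = y)) (hend : walkEnd u l = u) :
    G.StronglyConnectedOn (u :: l).toFinset := by
  have key : ∀ (l : List V) (u : V) (W : Finset V), (∀ x ∈ u :: l, x ∈ W) →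
      (u :: l).IsChain (fun x y => G.Adj x y ∨ x = y) →
      ∀ x ∈ u :: l, G.Reaches W u x ∧ G.Reaches W x (walkEnd u l) := by
    intro l
    induction l with
    | nil =>
      intro u W _ _ x hx
      have : x = u := by simpa using hx
      subst this
      exact ⟨.refl, .refl⟩
    | cons v l ih =>
      intro u W hW hc x hx
      rw [List.isChain_cons_cons] at hc
      have hW' : ∀ x ∈ v :: l, x ∈ W := fun x hx => hW x (List.mem_cons_of_mem _ hx)
      have huv : G.Reaches W u v := by
        rcases hc.1 with huv | rfl
        · exact .single ⟨hW u List.mem_cons_self, hW' v List.mem_cons_self, huv⟩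
        · exact .refl
      have hi := ih v W hW' hc.2
      rcases List.mem_cons.mp hx with rfl | hx
      · exact ⟨.refl, huv.trans (hi v List.mem_cons_self).2⟩
      · exact ⟨huv.trans (hi x hx).1, (hi x hx).2⟩
  have hk := key l u (u :: l).toFinset (fun x hx => List.mem_toFinset.mpr hx) h
  intro x hx y hy
  have h1 := (hk x (List.mem_toFinset.mp hx)).2
  rw [hend] at h1
  exact h1.trans (hk y (List.mem_toFinset.mp hy)).1

/-- The number of closed lifts of a closed walk that visits exactly the vertices of `S` is the
number of spanning forests with set of roots `S`. -/
theorem card_moves_eq_self {V : Type*} [Fintype V] [DecidableEq V] {G : Digraph V}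
    (hloop : ∀ v, ¬ G.Adj v v) {v : V} {l : List V}
    (h : (v :: l).IsChain (fun x y => G.Adj x y ∨ x = y)) (hend : walkEnd v l = v) :
    (Finset.univ.filter (fun a : G.SpanningTree => a.root = v ∧ a.moves l = a)).card
      = (G.forests (v :: l).toFinset).card := by
  refine Finset.card_bij (fun a _ => a.outside (v :: l).toFinset) ?_ ?_ ?_
  · intro a ha
    simp only [Finset.mem_filter, Finset.mem_univ, true_and, forests] at ha ⊢
    exact a.isForest_outside (by simp [ha.1])
  · intro a ha b hb hab
    simp only [Finset.mem_filter, Finset.mem_univ, true_and] at ha hb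
    obtain ⟨rfl, ha⟩ := ha
    refine SpanningTree.ext_of_outside_eq hb.1.symm hab fun e he => ?_
    have := SpanningTree.mem_edges_moves_of_mem hb.1.symm h (List.mem_toFinset.mp he)
    rwa [ha, hb.2] at this
  · intro f hf
    simp only [Finset.mem_filter, Finset.mem_univ, true_and, forests] at hf
    classical
    obtain ⟨a, rfl, ha, -⟩ := exists_outside_eq hloop (linearOrderOfSTO WellOrderingRel) hf
      (stronglyConnectedOn_of_isChain h hend) (List.mem_toFinset.mpr List.mem_cons_self)
    have hr : (a.moves l).root = a.root := (SpanningTree.root_moves h).trans hend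
    have hout : ∀ b : G.SpanningTree, b.root = a.root →
        (b.moves l).outside (a.root :: l).toFinset = b.outside (a.root :: l).toFinset := by
      intro b hb
      ext e
      rw [SpanningTree.mem_outside, SpanningTree.mem_outside]
      refine and_congr_left fun he => ?_
      rw [List.mem_toFinset] at he
      rw [← hb] at h he
      exact SpanningTree.mem_edges_moves_of_notMem h he
    -- Walking along `l` a second time does not change the tree.
    refine ⟨a.moves l, ?_, (hout a rfl).trans ha⟩
    simp only [Finset.mem_filter, Finset.mem_univ, true_and]
    refine ⟨hr, SpanningTree.ext_of_outside_eq ?_ (hout _ hr) fun e he => ?_⟩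
    · rw [SpanningTree.root_moves (hr.symm ▸ h), hr, hend]
    · exact (SpanningTree.mem_edges_moves_of_mem hr.symm h (List.mem_toFinset.mp he)).symm

/-! ### Traces of powers -/

theorem trace_liftedSchrodinger_pow {V : Type*} [Fintype V] [DecidableEq V] {G : Digraph V}
    (hloop : ∀ v, ¬ G.Adj v v) (k : ℕ) :
    (G.liftedSchrodinger ^ k).trace = ∑ v, ∑ l ∈ words V k, if walkEnd v l = v then
      ((G.forests (v :: l).toFinset).card : G.WeightRing) * walkWeight G.schrodinger v l else 0 := by
  have h1 : (G.liftedSchrodinger ^ k).trace = ∑ v, ∑ l ∈ words V k,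
      ∑ a : G.SpanningTree with a.root = v,
        if a.moves l = a then walkWeight G.schrodinger v l else 0 := by
    simp only [Matrix.trace, Matrix.diag_apply, liftedSchrodinger_pow_apply]
    rw [← Finset.sum_fiberwise Finset.univ SpanningTree.root]
    refine Finset.sum_congr rfl fun v _ => ?_
    rw [Finset.sum_comm]
    refine Finset.sum_congr rfl fun l _ => Finset.sum_congr rfl fun a ha => ?_
    rw [(Finset.mem_filter.mp ha).2]
  rw [h1]
  refine Finset.sum_congr rfl fun v _ => Finset.sum_congr rfl fun l _ => ?_
  by_cases hw : walkWeight G.schrodinger v l = 0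
  · simp [hw]
  have hc := isChain_of_walkWeight_ne_zero hw
  split_ifs with hend
  · rw [← card_moves_eq_self hloop hc hend, ← Finset.sum_filter, Finset.filter_filter,
      Finset.sum_const, nsmul_eq_mul]
  · refine Finset.sum_eq_zero fun a ha => if_neg fun h => hend ?_
    have ha := (Finset.mem_filter.mp ha).2
    rw [← ha] at hc ⊢
    rw [← SpanningTree.root_moves hc, h]

theorem trace_schrodingerOn_pow {V : Type*} [Fintype V] [DecidableEq V] (G : Digraph V)
    (W : Finset V) (k : ℕ) :
    (G.schrodingerOn W ^ k).trace = ∑ v, ∑ l ∈ words V k, if walkEnd v l = v then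
      (if (v :: l).toFinset ⊆ W then walkWeight G.schrodinger v l else 0) else 0 := by
  have hsub : ∀ (v : V) (l : List V), (v :: l).toFinset ⊆ W ↔ v ∈ W ∧ ∀ x ∈ l, x ∈ W := by
    intro v l
    simp [Finset.subset_iff]
  simp only [Matrix.trace, Matrix.diag_apply, schrodingerOn, submatrix_pow_apply, hsub]
  rw [← Finset.sum_subset (Finset.subset_univ W) (fun x _ hx => by simp [hx]),
    ← Finset.sum_coe_sort W]
  refine Finset.sum_congr rfl fun v _ => Finset.sum_congr rfl fun l _ => ?_
  simp only [v.2, true_and, ← ite_and]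
  exact if_congr and_comm rfl rfl

end Digraph

end

theorem theorem3p3 {V : Type*} [Fintype V] [DecidableEq V] (G : Digraph V)
    (hloop : ∀ v, ¬ G.Adj v v) (hG : G.StronglyConnected) :
    ∃ m : Finset V → ℕ,
      (∀ (o : LinearOrder V) (W : Finset V), G.StronglyConnectedOn W →
        ∀ w ∈ W, G.multiplicity o W w = m W) ∧
      G.liftedSchrodinger.det =
        ∏ W ∈ G.stronglyConnectedSubsets, (G.schrodingerOn W).det ^ m W := by
  classical
  let o₀ : LinearOrder V := linearOrderOfSTO WellOrderingRel
  -- The value at `∅` is irrelevant, since the principal submatrix on `∅` has determinant `1`.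
  let m : Finset V → ℕ := fun W => if h : W.Nonempty then G.multiplicity o₀ W h.choose else 0
  have hm : ∀ (o : LinearOrder V) (W : Finset V), G.StronglyConnectedOn W →
      ∀ w ∈ W, G.multiplicity o W w = m W := by
    intro o W hW w hw
    have hne : W.Nonempty := ⟨w, hw⟩
    simp only [m, dif_pos hne]
    exact Digraph.multiplicity_eq hloop o o₀ hW hw hne.choose_spec
  refine ⟨m, hm, ?_⟩
  refine Matrix.det_eq_prod_det_pow_of_trace_pow _ (fun W : Finset V => W) _
    (fun W => G.schrodingerOn W) m fun k => ?_
  simp only [Digraph.trace_liftedSchrodinger_pow hloop, Digraph.trace_schrodingerOn_pow,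
    Finset.mul_sum]
  rw [Finset.sum_comm (s := G.stronglyConnectedSubsets)]
  refine Finset.sum_congr rfl fun v _ => ?_
  rw [Finset.sum_comm (s := G.stronglyConnectedSubsets)]
  refine Finset.sum_congr rfl fun l _ => ?_
  split_ifs with hend
  · by_cases hw : Digraph.walkWeight G.schrodinger v l = 0
    · simp [hw]
    have hsc := Digraph.stronglyConnectedOn_of_isChain
      (Digraph.isChain_of_walkWeight_ne_zero hw) hend
    have hv : v ∈ (v :: l).toFinset := List.mem_toFinset.mpr List.mem_cons_self
    rw [← Digraph.sum_multiplicity hloop o₀ hsc hv, Nat.cast_sum, Finset.sum_mul,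
      Finset.sum_filter]
    refine Finset.sum_congr rfl fun W hW => ?_
    split_ifs with hsub
    · rw [hm o₀ W (Digraph.mem_stronglyConnectedSubsets.mp hW) v (hsub hv)]
    · simp
  · simp
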